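/- Let $a\in\mathbb R$, $\lambda>0$. For each $N\ge 1$ let $\{\xi_{i,j}(s):1\le i,j\le N,\ s\ge 1\}$ (possibly depending on $N$) be i.i.d. real random variables with the Gumbel law $G(a,\lambda)$, i.e. $\mathbb P(\xi_{i,j}(s)\le x)=\exp(-e^{-\lambda(x-a)})$, independent of the initial configuration $X(0)=(X_i(0))_{1\le i\le N}$, a (deterministic or random) vector of $\mathbb R^N$. All these variables, for all $N$, are defined on one probability space; nothing is assumed on the joint law for different $N$. Define $$X_i(t+1)=\max_{1\le j\le N}\{X_j(t)+\xi_{i,j}(t+1)\},\qquad t\ge 0,$$ $$U_N(t,x)=\frac1N\sum_{i=1}^N \mathbf 1_{X_i(t)>x},\qquad \Phi(y)=\lambda^{-1}\ln\sum_{i=1}^N e^{\lambda y_i}\quad (y\in\mathbb R^N),$$ $$u(x)=1-\exp(-e^{-\lambda(x-a)}),$$ and let $\mathcal F_t$ be the $\sigma$-algebra generated by the initial configurations and by the variables $\xi_{i,j}(s)$, $1\le s\le t$, of the systems of all sizes $N$. Let $b_N=N\,\mathbb E(\mathcal E^{-1};\mathcal E^{-1}<N)$ with $\mathcal E$ exponential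 of parameter $1$. Then: (i) For every integer $t\ge 1$, almost surely, and also with conditional probability $1$ given $\mathcal F_{t-1}$ almost surely, $$U_N\big(t,x+\Phi(X(t-1))\big)\longrightarrow u(x)\quad\text{as }N\to\infty,\text{ uniformly in }x\in\mathbb R.$$ (ii) There is a real random variable $\mathcal S$ (totally asymmetric stable of index $1$) with characteristic function $$\mathbb E e^{iv\mathcal S}=\exp\Big\{\int_1^\infty(e^{ivx}-1)\frac{dx}{x^2}+\int_0^1(e^{ivx}-1-ivx)\frac{dx}{x^2}\Big\},\qquad v\in\mathbb R,$$ such that for every integer $t\ge1$ and every $x\in\mathbb R$, as $N\to\infty$, $$\ln N\,\Big\{U_N\big(t,\,x+(t-1)(\lambda^{-1}\ln b_N+a)+\Phi(X(0))\big)-u(x)\Big\}\ \stackrel{\rm law}{\longrightarrow}\ -\frac{u'(x)}{\lambda}\Big((t-1)\,\mathcal S+(t-1)\ln(t-1)\Big),$$ where $0\ln 0=0$. -/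

import Mathlib

open MeasureTheory ProbabilityTheory Filter

open scoped Topology

noncomputable section

/-- `Y` is a real random variable with the Gumbel law `G(a, lam)`, i.e. with distribution
function `x ↦ exp (-exp (-lam (x - a)))`. -/
def HasGumbelLaw {Ω : Type*} [MeasurableSpace Ω] (P : Measure Ω) (a lam : ℝ) (Y : Ω → ℝ) : Prop :=
  Measurable Y ∧
    ∀ x : ℝ, P.real {ω | Y ω ≤ x} = Real.exp (-Real.exp (-(lam * (x - a))))

/-- The positions of the `N` particles at time `t`, for the initial configuration `x₀` and the
noise `ξ` (`ξ s i j` is the jump at time `s ≥ 1` from the particle `j` to the particle `i`; the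
values at `s = 0` are never used):
`X_i(t+1) = max_j (X_j(t) + ξ_{i,j}(t+1))`. -/
def particles {N : ℕ} (x₀ : Fin N → ℝ) (ξ : ℕ → Fin N → Fin N → ℝ) : ℕ → Fin N → ℝ
  | 0 => x₀
  | t + 1 => fun i =>
      Finset.univ.sup' ⟨i, Finset.mem_univ i⟩ (fun j => particles x₀ ξ t j + ξ (t + 1) i j)

/-- The front location `Φ(y) = lam⁻¹ ln ∑ exp (lam y_i)`. -/
def frontLocation {N : ℕ} (lam : ℝ) (y : Fin N → ℝ) : ℝ :=
  lam⁻¹ * Real.log (∑ i, Real.exp (lam * y i))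

/-- The proportion of the coordinates of `y` lying in `(x, ∞)`. The front profile `U_N(t, x)` is
`frontProfile (X(t)) x`. -/
def frontProfile {N : ℕ} (y : Fin N → ℝ) (x : ℝ) : ℝ :=
  (N : ℝ)⁻¹ * ∑ i, if x < y i then (1 : ℝ) else 0

/-- The limit profile `u(x) = 1 - exp (-exp (-lam (x - a)))`. -/
def limitProfile (a lam x : ℝ) : ℝ :=
  1 - Real.exp (-Real.exp (-(lam * (x - a))))

/-- `b_N = N 𝔼(ℰ⁻¹; ℰ⁻¹ < N)` where `ℰ` is exponential with parameter `1`. -/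
def centering (N : ℕ) : ℝ :=
  (N : ℝ) * ∫ y in {y : ℝ | y⁻¹ < (N : ℝ)}, y⁻¹ ∂(expMeasure 1)

/-- The Lévy exponent
`∫_1^∞ (e^{ivx} - 1) dx/x² + ∫_0^1 (e^{ivx} - 1 - ivx) dx/x²`
of the totally asymmetric stable law of index `1`. -/
def stableExponent (v : ℝ) : ℂ :=
  (∫ x in Set.Ioi (1 : ℝ), (Complex.exp (Complex.I * v * x) - 1) / (x : ℂ) ^ 2) +
    ∫ x in Set.Ioc (0 : ℝ) 1,
      (Complex.exp (Complex.I * v * x) - 1 - Complex.I * v * x) / (x : ℂ) ^ 2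

/-- The information up to time `t`: the σ-algebra generated by the initial configurations and by
the noises at the times `1, …, t`, for the systems of all sizes `N`. -/
@[reducible] def pastSigmaAlgebra {Ω : Type*} (X₀ : (N : ℕ) → Ω → Fin N → ℝ)
    (ξ : (N : ℕ) → ℕ → Fin N → Fin N → Ω → ℝ) (t : ℕ) : MeasurableSpace Ω :=
  (⨆ N : ℕ, MeasurableSpace.comap (X₀ N) inferInstance) ⊔
    ⨆ (N : ℕ) (s ∈ Set.Icc 1 t) (i : Fin N) (j : Fin N),
      MeasurableSpace.comap (ξ N s i j) inferInstance

/-- The configuration at time `t` of the system of size `N`, as a random vector. -/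
def randomParticles {Ω : Type*} (X₀ : (N : ℕ) → Ω → Fin N → ℝ)
    (ξ : (N : ℕ) → ℕ → Fin N → Fin N → Ω → ℝ) (N t : ℕ) (ω : Ω) : Fin N → ℝ :=
  particles (X₀ N ω) (fun s i j => ξ N s i j ω) t

/-- The event that, as `N → ∞`, the profile at time `t`, recentred by the front location at time
`t - 1`, converges to the limit profile uniformly on the real line. -/
def profileConvergence {Ω : Type*} (a lam : ℝ) (X₀ : (N : ℕ) → Ω → Fin N → ℝ)
    (ξ : (N : ℕ) → ℕ → Fin N → Fin N → Ω → ℝ) (t : ℕ) : Set Ω :=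
  {ω | TendstoUniformly
    (fun (N : ℕ) (x : ℝ) => frontProfile (randomParticles X₀ ξ N t ω)
      (x + frontLocation lam (randomParticles X₀ ξ N (t - 1) ω)))
    (limitProfile a lam) atTop}

end

/-! ### Exponential and Gumbel laws -/

noncomputable section

/-! Everything rests on max-stability: for fixed `z`, the maximum of the `z j + r j` with i.i.d.
Gumbel `r j` is a Gumbel variable translated by `Φ(z)` (`map_sup'_pi_gumbelMeasure`). Given the
past, `X(t+1) - Φ(X(t))` therefore consists of `N` i.i.d. Gumbel variables whose law does not depend
on the past, so it is independent of `(X(0), X(t))` (`map_history_recentred`).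

Part (i) is then a Glivenko-Cantelli theorem for a triangular array. Hoeffding's bound is summable
in `N`, so Borel-Cantelli applies whatever the joint law for different `N`, and monotonicity makes
the convergence uniform.

For (ii), `Φ(X(k)) - Φ(X(0))` is a sum of `k` independent copies of `Φ(r)`, `r` i.i.d. Gumbel. Since
`exp (lam (r_i - a))` has the law of `1/ℰ`, one has `exp (lam (Φ(r) - a)) = b_N (1 + V_N / m_N)`,
where `m_N ~ log N` is the truncated mean and `V_N` is the centred sum of the inverses divided by
`N`. `V_N` converges to the stable law (`tendsto_exp_mul_invExpCharFun_pow`), so `log N (lam (Φ(r) -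
a) - log b_N)` has the same limit. The sum of `k` copies of `𝒮` has the law of `k 𝒮 + k log k`
(`stableExponent_mul`). Finally, the empirical profile differs from `u` by `o(1 / log N)` in
probability, even at a level depending on the past (`measureReal_recentred_ge_le`), so the
fluctuations of order `1 / log N` come only from the displacement of the front, through the
derivative of `u`. -/

instance isProbabilityMeasure_expMeasure_one : IsProbabilityMeasure (expMeasure 1) :=
  isProbabilityMeasure_expMeasure one_pos

lemma integral_expMeasure_one {E : Type*} [NormedAddCommGroup E] [NormedSpace ℝ E] (f : ℝ → E) :
    ∫ y, f y ∂(expMeasure 1) = ∫ y in Set.Ioi (0 : ℝ), Real.exp (-y) • f y := by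
  have h : expMeasure 1 = volume.withDensity (exponentialPDF 1) := rfl
  rw [h, integral_withDensity_eq_integral_toReal_smul₀
    (by exact (measurable_exponentialPDFReal 1).ennreal_ofReal.aemeasurable)
    (by simp [exponentialPDF]), ← integral_indicator measurableSet_Ioi]
  refine integral_congr_ae ?_
  have : ∀ᵐ y : ℝ, y ≠ 0 := by simp [ae_iff]
  filter_upwards [this] with y hy
  rcases lt_or_gt_of_ne hy with h | h
  · simp [exponentialPDF_eq, h.not_ge, h.le]
  · simp [exponentialPDF_eq, h, h.le, (Real.exp_pos _).le]

lemma expMeasure_one_real_Iic {x : ℝ} (hx : 0 ≤ x) :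
    (expMeasure 1).real (Set.Iic x) = 1 - Real.exp (-x) := by
  rw [← cdf_eq_real, cdf_expMeasure_eq one_pos]
  simp [hx]

instance nullSingletonClass_expMeasure_one : NullSingletonClass (expMeasure 1) := by
  have h : expMeasure 1 = volume.withDensity (exponentialPDF 1) := rfl
  rw [h]; infer_instance

lemma ae_pos_expMeasure_one : ∀ᵐ y ∂(expMeasure 1), 0 < y := by
  rw [ae_iff]
  have : {y : ℝ | ¬ 0 < y} = Set.Iic 0 := by ext; simp
  rw [this, ← measureReal_eq_zero_iff, expMeasure_one_real_Iic le_rfl]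
  simp

/-- The Gumbel law `G(a, lam)` as the law of `a - lam⁻¹ log ℰ`, with `ℰ` exponential. -/
def gumbelMeasure (a lam : ℝ) : Measure ℝ :=
  (expMeasure 1).map (fun y => a - lam⁻¹ * Real.log y)

instance isProbabilityMeasure_gumbelMeasure (a lam : ℝ) :
    IsProbabilityMeasure (gumbelMeasure a lam) :=
  Measure.isProbabilityMeasure_map (by fun_prop)

lemma gumbelMeasure_real_Iic {a lam : ℝ} (hlam : 0 < lam) (x : ℝ) :
    (gumbelMeasure a lam).real (Set.Iic x) = Real.exp (-Real.exp (-(lam * (x - a)))) := by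
  rw [gumbelMeasure, map_measureReal_apply (by fun_prop) measurableSet_Iic]
  have h : (fun y => a - lam⁻¹ * Real.log y) ⁻¹' Set.Iic x
      =ᵐ[expMeasure 1] ((Set.Iic (Real.exp (-(lam * (x - a)))))ᶜ : Set ℝ) := by
    -- The map is decreasing on `(0, ∞)`, so the preimage is `[exp (-(lam (x - a))), ∞)` up to the
    -- null set where the logarithm takes its conventional values.
    refine EventuallyEq.trans (g := ((Set.Iio (Real.exp (-(lam * (x - a)))))ᶜ : Set ℝ)) ?_
      (Iio_ae_eq_Iic (μ := expMeasure 1)).compl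
    rw [eventuallyEq_set]
    filter_upwards [ae_pos_expMeasure_one] with y hy
    simp only [Set.mem_preimage, Set.mem_Iic, Set.mem_compl_iff, Set.mem_Iio, not_lt]
    rw [← Real.le_log_iff_exp_le hy, inv_mul_eq_div, sub_le_comm, le_div_iff₀ hlam]
    constructor <;> intro h <;> nlinarith
  rw [measureReal_congr h, probReal_compl_eq_one_sub measurableSet_Iic,
    expMeasure_one_real_Iic (Real.exp_pos _).le]
  ring

lemma HasGumbelLaw.map_eq {Ω : Type*} [MeasurableSpace Ω] {P : Measure Ω} [IsProbabilityMeasure P]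
    {a lam : ℝ} (hlam : 0 < lam) {Y : Ω → ℝ} (h : HasGumbelLaw P a lam Y) :
    P.map Y = gumbelMeasure a lam := by
  have : IsProbabilityMeasure (P.map Y) := Measure.isProbabilityMeasure_map h.1.aemeasurable
  refine Measure.ext_of_Iic _ _ fun x => ?_
  rw [← measureReal_eq_measureReal_iff, gumbelMeasure_real_Iic hlam,
    map_measureReal_apply h.1 measurableSet_Iic]
  exact h.2 x

/-! ### Max-stability and independence from the past -/

@[fun_prop]
lemma measurable_frontLocation {N : ℕ} (lam : ℝ) :
    Measurable (frontLocation lam : (Fin N → ℝ) → ℝ) := by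
  unfold frontLocation; fun_prop

@[fun_prop]
lemma measurable_frontProfile {N : ℕ} :
    Measurable (fun p : (Fin N → ℝ) × ℝ => frontProfile p.1 p.2) := by
  unfold frontProfile
  refine Measurable.const_mul (Finset.measurable_sum _ fun i _ => ?_) _
  exact Measurable.ite (measurableSet_lt (by fun_prop) (by fun_prop)) (by fun_prop) (by fun_prop)

lemma measurable_sup'_univ {E : Type*} [MeasurableSpace E] {N : ℕ}
    (h : (Finset.univ : Finset (Fin N)).Nonempty) {f : E → Fin N → ℝ}
    (hf : ∀ j, Measurable fun e => f e j) : Measurable fun e => Finset.univ.sup' h (f e) := by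
  have := Finset.measurable_sup' h (f := fun j e => f e j) (fun j _ => hf j)
  convert this using 1
  ext e
  rw [Finset.sup'_apply]

/-- The maximum of Gumbel variables translated by `z` is, up to the translation by
`frontLocation lam z`, a Gumbel variable. -/
lemma map_sup'_pi_gumbelMeasure {a lam : ℝ} (hlam : 0 < lam) {N : ℕ} (i : Fin N)
    (z : Fin N → ℝ) :
    (Measure.pi fun _ : Fin N => gumbelMeasure a lam).map
      (fun r => Finset.univ.sup' ⟨i, Finset.mem_univ i⟩ (fun j => z j + r j)
        - frontLocation lam z) = gumbelMeasure a lam := by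
  have hm : Measurable (fun r : Fin N → ℝ =>
      Finset.univ.sup' ⟨i, Finset.mem_univ i⟩ (fun j => z j + r j) - frontLocation lam z) := by
    exact (measurable_sup'_univ _ fun j => by fun_prop).sub_const _
  have : IsProbabilityMeasure ((Measure.pi fun _ : Fin N => gumbelMeasure a lam).map
      (fun r => Finset.univ.sup' ⟨i, Finset.mem_univ i⟩ (fun j => z j + r j)
        - frontLocation lam z)) := Measure.isProbabilityMeasure_map hm.aemeasurable
  refine Measure.ext_of_Iic _ _ fun x => ?_
  rw [← measureReal_eq_measureReal_iff, gumbelMeasure_real_Iic hlam,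
    map_measureReal_apply hm measurableSet_Iic]
  have hset : (fun r : Fin N → ℝ => Finset.univ.sup' ⟨i, Finset.mem_univ i⟩ (fun j => z j + r j)
        - frontLocation lam z) ⁻¹' Set.Iic x
      = Set.univ.pi fun j => Set.Iic (x + frontLocation lam z - z j) := by
    ext r
    rw [Set.mem_preimage, Set.mem_Iic, sub_le_iff_le_add, Set.mem_univ_pi]
    refine (Finset.sup'_le_iff _ _).trans ?_
    refine forall_congr' fun j => ?_
    rw [Set.mem_Iic, le_sub_iff_add_le, add_comm (r j)]
    simp
  rw [hset, measureReal_def, Measure.pi_pi, ENNReal.toReal_prod]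
  simp_rw [← measureReal_def, gumbelMeasure_real_Iic hlam]
  rw [← Real.exp_sum, Finset.sum_neg_distrib]
  have hpos : 0 < ∑ j, Real.exp (lam * z j) :=
    Finset.sum_pos (fun j _ => Real.exp_pos _) ⟨i, Finset.mem_univ i⟩
  have hfront : Real.exp (lam * frontLocation lam z) = ∑ j, Real.exp (lam * z j) := by
    rw [frontLocation, mul_inv_cancel_left₀ hlam.ne', Real.exp_log hpos]
  -- Summed over `j`, the last factors give `exp (lam Φ(z))`, which cancels the middle one: this
  -- identity is what defines `Φ`.
  have : ∀ j, Real.exp (-(lam * (x + frontLocation lam z - z j - a)))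
      = Real.exp (-(lam * (x - a))) * (Real.exp (lam * frontLocation lam z))⁻¹
        * Real.exp (lam * z j) := by
    intro j
    rw [← Real.exp_neg, ← Real.exp_add, ← Real.exp_add]
    congr 1; ring
  simp_rw [this]
  rw [← Finset.mul_sum, ← hfront, mul_assoc, inv_mul_cancel₀ (Real.exp_pos _).ne', mul_one]

lemma exp_mul_frontLocation {N : ℕ} [NeZero N] {lam : ℝ} (hlam : 0 < lam) (y : Fin N → ℝ) :
    Real.exp (lam * frontLocation lam y) = ∑ i, Real.exp (lam * y i) := by
  rw [frontLocation, mul_inv_cancel_left₀ hlam.ne', Real.exp_log]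
  exact Finset.sum_pos (fun j _ => Real.exp_pos _) ⟨0, Finset.mem_univ 0⟩

lemma frontLocation_sub {N : ℕ} [NeZero N] {lam : ℝ} (hlam : 0 < lam) (y : Fin N → ℝ) (c : ℝ) :
    frontLocation lam (fun i => y i - c) = frontLocation lam y - c := by
  have : ∀ i, Real.exp (lam * (y i - c)) = Real.exp (lam * y i) * Real.exp (-(lam * c)) := by
    intro i; rw [← Real.exp_add]; ring_nf
  have hpos : 0 < ∑ i, Real.exp (lam * y i) :=
    Finset.sum_pos (fun j _ => Real.exp_pos _) ⟨0, Finset.mem_univ 0⟩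
  simp only [frontLocation, this]
  rw [← Finset.sum_mul, Real.log_mul hpos.ne' (Real.exp_pos _).ne', Real.log_exp]
  field_simp
  ring

lemma frontProfile_sub {N : ℕ} (y : Fin N → ℝ) (c x : ℝ) :
    frontProfile (fun i => y i - c) x = frontProfile y (x + c) := by
  simp only [frontProfile, lt_sub_iff_add_lt]

/-- Three-fold independence, regrouped. -/
lemma IndepFun.prodMk_left_of_prodMk_right {Ω α β γ : Type*} [MeasurableSpace Ω]
    [MeasurableSpace α] [MeasurableSpace β] [MeasurableSpace γ] {P : Measure Ω}
    [IsProbabilityMeasure P] {X : Ω → α} {A : Ω → β} {B : Ω → γ}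
    (hX : Measurable X) (hA : Measurable A) (hB : Measurable B)
    (h : IndepFun X (fun ω => (A ω, B ω)) P) (hAB : IndepFun A B P) :
    IndepFun (fun ω => (X ω, A ω)) B P := by
  have hXA : IndepFun X A P := h.comp measurable_id measurable_fst
  have := Measure.isProbabilityMeasure_map (μ := P) hX.aemeasurable
  have := Measure.isProbabilityMeasure_map (μ := P) hA.aemeasurable
  have := Measure.isProbabilityMeasure_map (μ := P) hB.aemeasurable
  rw [indepFun_iff_map_prod_eq_prod_map_map (by fun_prop) (by fun_prop)] at h hAB hXA ⊢
  rw [hXA, ← (MeasurableEquiv.prodAssoc).map_measurableEquiv_injective.eq_iff,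
    Measure.prodAssoc_prod, ← hAB, ← h, Measure.map_map (by fun_prop) (by fun_prop)]
  rfl

/-- Given the past `Z`, the configuration obtained from `z Z` with an independent Gumbel noise `η`
consists, after recentring, of i.i.d. Gumbel variables. -/
lemma map_prodMk_recentred {Ω E : Type*} [MeasurableSpace Ω] [MeasurableSpace E] {P : Measure Ω}
    [IsProbabilityMeasure P] {a lam : ℝ} (hlam : 0 < lam) {N : ℕ} {Z : Ω → E} (hZ : Measurable Z)
    {z : E → Fin N → ℝ} (hz : Measurable z) {η : Ω → Fin N → Fin N → ℝ} (hη : Measurable η)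
    (hη_law : P.map η = Measure.pi fun _ => Measure.pi fun _ => gumbelMeasure a lam)
    (hind : IndepFun Z η P) :
    P.map (fun ω => (Z ω, fun i : Fin N => Finset.univ.sup' ⟨i, Finset.mem_univ i⟩
        (fun j => z (Z ω) j + η ω i j) - frontLocation lam (z (Z ω))))
      = (P.map Z).prod (Measure.pi fun _ => gumbelMeasure a lam) := by
  have := Measure.isProbabilityMeasure_map (μ := P) hZ.aemeasurable
  have hg : Measurable (Function.uncurry fun (e : E) (r : Fin N → Fin N → ℝ) (i : Fin N) =>
      Finset.univ.sup' ⟨i, Finset.mem_univ i⟩ (fun j => z e j + r i j)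
        - frontLocation lam (z e)) := by
    exact measurable_pi_lambda _ fun i =>
      (measurable_sup'_univ _ fun j => by fun_prop).sub (by fun_prop)
  -- For each frozen past `e`, the noise is mapped to the same law; a skew product whose fibre law
  -- is constant is a product measure.
  have key := ((MeasurePreserving.id (P.map Z)).skew_product hg
    (μc := Measure.pi fun _ : Fin N => Measure.pi fun _ : Fin N => gumbelMeasure a lam)
    (μd := Measure.pi fun _ : Fin N => gumbelMeasure a lam) (Eventually.of_forall fun e => ?_))
  · rw [← key.map_eq, ← hη_law,
      ← (indepFun_iff_map_prod_eq_prod_map_map hZ.aemeasurable hη.aemeasurable).1 hind,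
      Measure.map_map key.measurable (by fun_prop)]
    rfl
  · have hm : ∀ i, Measurable (fun r : Fin N → ℝ =>
        Finset.univ.sup' ⟨i, Finset.mem_univ i⟩ (fun j => z e j + r j)
          - frontLocation lam (z e)) := fun i =>
      (measurable_sup'_univ _ fun j => by fun_prop).sub_const _
    have := fun i => Measure.isProbabilityMeasure_map
      (μ := Measure.pi fun _ : Fin N => gumbelMeasure a lam) (hm i).aemeasurable
    rw [Measure.pi_map_pi (f := fun i (r : Fin N → ℝ) =>
        Finset.univ.sup' ⟨i, Finset.mem_univ i⟩ (fun j => z e j + r j)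
          - frontLocation lam (z e)) (fun i => (hm i).aemeasurable)]
    congr 1
    ext1 i
    exact map_sup'_pi_gumbelMeasure hlam i (z e)

/-! ### The system of a fixed size -/

section SingleSize

variable {Ω : Type*} {N : ℕ} {X₀ : Ω → Fin N → ℝ} {ξ : ℕ → Fin N → Fin N → Ω → ℝ}

/-- The initial configuration and the noise at the times `1, …, t`. -/
def history (X₀ : Ω → Fin N → ℝ) (ξ : ℕ → Fin N → Fin N → Ω → ℝ) (t : ℕ) (ω : Ω) :
    (Fin N → ℝ) × ((Finset.range t ×ˢ (Finset.univ : Finset (Fin N × Fin N)) :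
      Finset (ℕ × Fin N × Fin N)) → ℝ) :=
  (X₀ ω, fun p => ξ (p.1.1 + 1) p.1.2.1 p.1.2.2 ω)

lemma comap_history_mono : Monotone fun t =>
    MeasurableSpace.comap (history X₀ ξ t) inferInstance := by
  intro s t hst
  rw [← measurable_iff_comap_le]
  have hsub : ∀ p ∈ (Finset.range s ×ˢ (Finset.univ : Finset (Fin N × Fin N))),
      p ∈ (Finset.range t ×ˢ (Finset.univ : Finset (Fin N × Fin N))) := by
    intro p hp; simp at hp ⊢; omega
  have : history X₀ ξ s = (fun q => (q.1, fun p => q.2 ⟨p.1, hsub p.1 p.2⟩)) ∘ history X₀ ξ t :=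
    rfl
  rw [this]
  refine Measurable.comp ?_ (comap_measurable _)
  fun_prop

/-- Measurability with respect to the history, and not merely on `Ω`, is what transfers the
independence of the fresh noise from the history to `X(t)`. -/
lemma measurable_particles_history (t : ℕ) :
    Measurable[MeasurableSpace.comap (history X₀ ξ t) inferInstance]
      (fun ω => particles (X₀ ω) (fun s i j => ξ s i j ω) t) := by
  induction t with
  | zero => exact measurable_fst.comp (comap_measurable (history X₀ ξ 0))
  | succ t ih =>
    have ih' := ih.mono (comap_history_mono (X₀ := X₀) (ξ := ξ) (Nat.le_succ t)) le_rfl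
    have hξ : ∀ i j, Measurable[MeasurableSpace.comap (history X₀ ξ (t + 1)) inferInstance]
        (ξ (t + 1) i j) := by
      intro i j
      have : ξ (t + 1) i j = (fun q => q.2 ⟨(t, i, j), by simp⟩) ∘ history X₀ ξ (t + 1) := rfl
      rw [this]
      refine Measurable.comp ?_ (comap_measurable _)
      fun_prop
    let := MeasurableSpace.comap (history X₀ ξ (t + 1)) inferInstance
    exact measurable_pi_lambda _ fun i => measurable_sup'_univ ⟨i, Finset.mem_univ i⟩
      fun j => ((measurable_pi_apply j).comp ih').add (hξ i j)

variable [MeasurableSpace Ω] {P : Measure Ω} [IsProbabilityMeasure P] {a lam : ℝ}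

lemma map_noise_eq (hlam : 0 < lam) (hξ_law : ∀ s ≥ 1, ∀ i j, HasGumbelLaw P a lam (ξ s i j))
    (hξ_indep : iIndepFun (fun (p : ℕ × Fin N × Fin N) => ξ (p.1 + 1) p.2.1 p.2.2) P) (t : ℕ) :
    P.map (fun ω i j => ξ (t + 1) i j ω)
      = Measure.pi fun _ => Measure.pi fun _ => gumbelMeasure a lam := by
  have hm : ∀ q : Fin N × Fin N, Measurable (ξ (t + 1) q.1 q.2) :=
    fun q => (hξ_law (t + 1) (by omega) q.1 q.2).1
  -- The family is indexed from `0`, so the index `t` stands for the time `t + 1`.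
  have h1 : iIndepFun (fun q : Fin N × Fin N => ξ (t + 1) q.1 q.2) P :=
    hξ_indep.precomp (g := fun q : Fin N × Fin N => (t, q)) (fun q q' h => by simpa using h)
  rw [iIndepFun_iff_map_fun_eq_pi_map fun q => (hm q).aemeasurable] at h1
  have h2 : ∀ q : Fin N × Fin N, P.map (ξ (t + 1) q.1 q.2) = gumbelMeasure a lam :=
    fun q => (hξ_law (t + 1) (by omega) q.1 q.2).map_eq hlam
  simp_rw [h2] at h1
  have h3 := Measure.infinitePi_map_curry (fun (_ _ : Fin N) => gumbelMeasure a lam)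
  simp_rw [Measure.infinitePi_eq_pi] at h3
  rw [← h3, ← h1, Measure.map_map (by fun_prop) (by fun_prop)]
  rfl

lemma measurable_history (hX₀ : Measurable X₀) (hξ : ∀ s ≥ 1, ∀ i j, Measurable (ξ s i j))
    (t : ℕ) : Measurable (history X₀ ξ t) :=
  hX₀.prodMk (measurable_pi_lambda _ fun _ => hξ _ (by omega) _ _)

lemma measurable_particles (hX₀ : Measurable X₀) (hξ : ∀ s ≥ 1, ∀ i j, Measurable (ξ s i j))
    (t : ℕ) : Measurable (fun ω => particles (X₀ ω) (fun s i j => ξ s i j ω) t) :=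
  (measurable_particles_history t).mono (measurable_history hX₀ hξ t).comap_le le_rfl

lemma indepFun_particles_noise (hX₀ : Measurable X₀) (hξ : ∀ s ≥ 1, ∀ i j, Measurable (ξ s i j))
    (hξ_indep : iIndepFun (fun (p : ℕ × Fin N × Fin N) => ξ (p.1 + 1) p.2.1 p.2.2) P)
    (hX₀_indep : IndepFun X₀
      (fun ω (p : ℕ × Fin N × Fin N) => ξ (p.1 + 1) p.2.1 p.2.2 ω) P) (t : ℕ) :
    IndepFun (history X₀ ξ t) (fun ω i j => ξ (t + 1) i j ω) P := by
  have hξ' : ∀ p : ℕ × Fin N × Fin N, Measurable (ξ (p.1 + 1) p.2.1 p.2.2) :=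
    fun p => hξ _ (by omega) _ _
  refine IndepFun.prodMk_left_of_prodMk_right hX₀ (by fun_prop) ?_ ?_ ?_
  · exact measurable_pi_lambda _ fun i => measurable_pi_lambda _ fun j => hξ _ (by omega) _ _
  · exact hX₀_indep.comp (φ := id) (ψ := fun f => ((fun p => f p.1, fun i j => f (t, i, j)) :
      ((Finset.range t ×ˢ (Finset.univ : Finset (Fin N × Fin N)) :
      Finset (ℕ × Fin N × Fin N)) → ℝ) × (Fin N → Fin N → ℝ))) measurable_id (by fun_prop)
  -- The times `1, …, t` and the time `t + 1` involve disjoint blocks of the noise.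
  · have := hξ_indep.indepFun_finset (Finset.range t ×ˢ Finset.univ) ({t} ×ˢ Finset.univ)
      (by rw [Finset.disjoint_left]; intro p hp hp'; simp only [Finset.mem_product, Finset.mem_range, Finset.mem_singleton] at hp hp'; omega) hξ'
    exact this.comp (φ := id) (ψ := fun f (i j : Fin N) => f ⟨(t, i, j), by simp⟩) measurable_id
      (measurable_pi_lambda _ fun i => measurable_pi_lambda _ fun j => measurable_pi_apply _)

/-- The configuration at time `t + 1`, recentred by the front location at time `t`. -/
def recentred (lam : ℝ) (X₀ : Ω → Fin N → ℝ) (ξ : ℕ → Fin N → Fin N → Ω → ℝ) (t : ℕ) (ω : Ω) :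
    Fin N → ℝ := fun i =>
  particles (X₀ ω) (fun s i j => ξ s i j ω) (t + 1) i
    - frontLocation lam (particles (X₀ ω) (fun s i j => ξ s i j ω) t)

/-- The initial configuration is kept next to `X(t)` because the centring in (ii) involves
`Φ(X(0))`: the profile is evaluated at a level that depends on both. -/
lemma map_history_recentred (hlam : 0 < lam) (hX₀ : Measurable X₀)
    (hξ_law : ∀ s ≥ 1, ∀ i j, HasGumbelLaw P a lam (ξ s i j))
    (hξ_indep : iIndepFun (fun (p : ℕ × Fin N × Fin N) => ξ (p.1 + 1) p.2.1 p.2.2) P)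
    (hX₀_indep : IndepFun X₀
      (fun ω (p : ℕ × Fin N × Fin N) => ξ (p.1 + 1) p.2.1 p.2.2 ω) P) (t : ℕ) :
    P.map (fun ω => ((X₀ ω, particles (X₀ ω) (fun s i j => ξ s i j ω) t),
        recentred lam X₀ ξ t ω))
      = (P.map fun ω => (X₀ ω, particles (X₀ ω) (fun s i j => ξ s i j ω) t)).prod
        (Measure.pi fun _ => gumbelMeasure a lam) := by
  have hξ : ∀ s ≥ 1, ∀ i j, Measurable (ξ s i j) := fun s hs i j => (hξ_law s hs i j).1
  have hη : Measurable (fun ω i j => ξ (t + 1) i j ω) :=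
    measurable_pi_lambda _ fun i => measurable_pi_lambda _ fun j => hξ _ (by omega) _ _
  have hZ : Measurable fun ω => (X₀ ω, particles (X₀ ω) (fun s i j => ξ s i j ω) t) :=
    hX₀.prodMk (measurable_particles hX₀ hξ t)
  refine map_prodMk_recentred hlam hZ measurable_snd hη
    (map_noise_eq hlam hξ_law hξ_indep t) ?_
  have h := indepFun_particles_noise hX₀ hξ hξ_indep hX₀_indep t
  refine indep_of_indep_of_le_left h ?_
  rw [← measurable_iff_comap_le]
  let := MeasurableSpace.comap (history X₀ ξ t) inferInstance
  exact (measurable_fst.comp (comap_measurable (history X₀ ξ t))).prodMk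
    (measurable_particles_history t)

end SingleSize

/-! ### The Lévy exponent -/

lemma norm_exp_I_mul_sub_one_sub_le (θ : ℝ) :
    ‖Complex.exp (Complex.I * θ) - 1 - Complex.I * θ‖ ≤ 3 * θ ^ 2 := by
  have hn : ‖Complex.I * (θ : ℂ)‖ = |θ| := by simp
  rcases le_or_gt |θ| 1 with h | h
  · have := Complex.norm_exp_sub_one_sub_id_le (x := Complex.I * θ) (by rwa [hn])
    rw [hn, sq_abs] at this
    nlinarith [sq_nonneg θ]
  · have h1 := Real.norm_exp_I_mul_ofReal_sub_one_le (x := θ)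
    have h2 := norm_sub_le (Complex.exp (Complex.I * θ) - 1) (Complex.I * θ)
    rw [hn] at h2
    rw [Real.norm_eq_abs] at h1
    nlinarith [sq_abs θ]

/-- The compensated integrand of the Lévy exponent, in the variable `w = 1 / x`. -/
def levyKernel (v w : ℝ) : ℂ :=
  Complex.exp (Complex.I * (v * w⁻¹ : ℝ)) - 1 - if 1 < w then Complex.I * (v * w⁻¹ : ℝ) else 0

@[fun_prop]
lemma measurable_levyKernel (v : ℝ) : Measurable (levyKernel v) := by
  unfold levyKernel
  refine Measurable.sub (by fun_prop) ?_
  exact Measurable.ite (measurableSet_lt (by fun_prop) (by fun_prop)) (by fun_prop) (by fun_prop)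

/-- The compensator gives the decay `v² / w²` for `w > 1`; for `w ≤ 1` boundedness is enough. The
dependence on `v` is explicit so that the bound is locally uniform in `v`. -/
lemma norm_levyKernel_le (v : ℝ) {w : ℝ} (hw : 0 < w) :
    ‖levyKernel v w‖ ≤ 6 * (1 + v ^ 2) * (1 + w ^ 2)⁻¹ := by
  rw [← div_eq_mul_inv, le_div_iff₀ (by positivity)]
  rcases lt_or_ge 1 w with h | h
  · rw [levyKernel, if_pos h]
    have h1 := norm_exp_I_mul_sub_one_sub_le (v * w⁻¹)
    have h2 : (v * w⁻¹) ^ 2 * (1 + w ^ 2) ≤ 2 * v ^ 2 := by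
      rw [mul_pow, inv_pow, ← div_eq_mul_inv, div_mul_eq_mul_div, div_le_iff₀ (by positivity)]
      nlinarith [sq_nonneg v, mul_nonneg (sq_nonneg v) (by nlinarith : (0:ℝ) ≤ w ^ 2 - 1)]
    nlinarith [mul_le_mul_of_nonneg_right h1 (by positivity : (0:ℝ) ≤ 1 + w ^ 2)]
  · rw [levyKernel, if_neg h.not_gt, sub_zero]
    have h1 : ‖Complex.exp (Complex.I * (v * w⁻¹ : ℝ)) - 1‖ ≤ 2 := by
      refine (norm_sub_le _ _).trans ?_
      rw [Complex.norm_exp_I_mul_ofReal]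
      norm_num
    have h2 : w ^ 2 ≤ 1 := by nlinarith
    nlinarith [sq_nonneg v, norm_nonneg (Complex.exp (Complex.I * (v * w⁻¹ : ℝ)) - 1),
      mul_le_mul h1 (by linarith : 1 + w ^ 2 ≤ 2) (by positivity) (by norm_num)]

lemma integrableOn_levyKernel (v : ℝ) : IntegrableOn (levyKernel v) (Set.Ioi 0) := by
  refine Integrable.mono' (g := fun w => 6 * (1 + v ^ 2) * (1 + w ^ 2)⁻¹)
    (integrable_inv_one_add_sq.integrableOn.const_mul _) (by fun_prop) ?_
  exact (ae_restrict_iff' measurableSet_Ioi).2 (Eventually.of_forall fun w hw =>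
    norm_levyKernel_le v hw)

/-- The substitution `w = 1 / x` turns `dx / x²` into Lebesgue measure and the compensated range `x
< 1` into `w > 1`. -/
lemma stableExponent_eq_integral (v : ℝ) :
    stableExponent v = ∫ w in Set.Ioi (0 : ℝ), levyKernel v w := by
  have hint := (integrableOn_Ioi_comp_rpow_iff (levyKernel v) (p := -1) (by norm_num)).2
    (integrableOn_levyKernel v)
  rw [← integral_comp_rpow_Ioi (levyKernel v) (p := -1) (by norm_num),
    ← Set.Ioc_union_Ioi_eq_Ioi (zero_le_one' ℝ),
    setIntegral_union (Set.Ioc_disjoint_Ioi le_rfl) measurableSet_Ioi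
      (hint.mono_set Set.Ioc_subset_Ioi_self) (hint.mono_set (Set.Ioi_subset_Ioi zero_le_one)),
    stableExponent, add_comm]
  have hcoe : ∀ x : ℝ, 0 < x →
      ((|(-1 : ℝ)| * x ^ ((-1 : ℝ) - 1) : ℝ)) = (x ^ 2)⁻¹ := by
    intro x hx
    rw [abs_neg, abs_one, one_mul, show (-1 : ℝ) - 1 = -(2 : ℕ) by norm_num,
      Real.rpow_neg hx.le, Real.rpow_natCast]
  congr 1
  -- The endpoint is dropped because `levyKernel` is not compensated at `w = 1`, whereas the
  -- integrand of `stableExponent` is at `x = 1`.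
  · rw [integral_Ioc_eq_integral_Ioo, integral_Ioc_eq_integral_Ioo]
    refine setIntegral_congr_fun measurableSet_Ioo fun x hx => ?_
    rw [hcoe x hx.1, Real.rpow_neg_one, levyKernel, if_pos ((one_lt_inv₀ hx.1).2 hx.2), inv_inv,
      Complex.real_smul]
    push_cast
    rw [div_eq_inv_mul, mul_assoc]
  · refine setIntegral_congr_fun measurableSet_Ioi fun x hx => ?_
    have hx0 : (0 : ℝ) < x := zero_lt_one.trans hx
    rw [hcoe x hx0, Real.rpow_neg_one, levyKernel,
      if_neg (not_lt.2 (inv_le_one_of_one_le₀ (le_of_lt hx))), inv_inv, Complex.real_smul]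
    push_cast
    rw [div_eq_inv_mul, mul_assoc, sub_zero]

/-- This is the hypothesis of Lévy's continuity theorem, through which the stable law is
constructed. -/
lemma continuousAt_stableExponent_zero : ContinuousAt stableExponent 0 := by
  have : stableExponent = fun v => ∫ w in Set.Ioi (0 : ℝ), levyKernel v w :=
    funext stableExponent_eq_integral
  rw [this]
  refine continuousAt_of_dominated (bound := fun w => 12 * (1 + w ^ 2)⁻¹)
    (Eventually.of_forall fun v => by fun_prop) ?_
    (integrable_inv_one_add_sq.integrableOn.const_mul _) ?_
  · filter_upwards [Metric.ball_mem_nhds (0 : ℝ) one_pos] with v hv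
    refine (ae_restrict_iff' measurableSet_Ioi).2 (Eventually.of_forall fun w hw =>
      (norm_levyKernel_le v hw).trans ?_)
    have : v ^ 2 ≤ 1 := by
      rw [mem_ball_zero_iff, Real.norm_eq_abs] at hv
      nlinarith [sq_abs v, abs_nonneg v]
    gcongr
    linarith
  · refine Eventually.of_forall fun w => ?_
    unfold levyKernel
    split_ifs <;> fun_prop

lemma stableExponent_zero : stableExponent 0 = 0 := by
  simp [stableExponent]

/-- Scaling `w` by `k` moves the compensation threshold from `1` to `1 / k`; the difference is the
integral of `i v / w` over `(1/k, 1]`, that is `i v log k`. -/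
lemma stableExponent_mul {k : ℝ} (hk : 1 ≤ k) (v : ℝ) :
    stableExponent (k * v) + Complex.I * (v * (k * Real.log k) : ℝ) = k * stableExponent v := by
  have hk0 : 0 < k := by linarith
  have h1 := integral_comp_mul_left_Ioi (levyKernel (k * v)) 0 hk0
  rw [mul_zero] at h1
  have h2 : stableExponent (k * v)
      = k * ∫ w in Set.Ioi (0 : ℝ), levyKernel (k * v) (k * w) := by
    rw [h1, stableExponent_eq_integral, Complex.real_smul, ← mul_assoc]
    push_cast
    rw [mul_inv_cancel₀ (by exact_mod_cast hk0.ne'), one_mul]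
  have h3 : ∀ w ∈ Set.Ioi (0 : ℝ), levyKernel (k * v) (k * w)
      = levyKernel v w - (Set.Ioc k⁻¹ 1).indicator (fun w => Complex.I * (v * w⁻¹ : ℝ)) w := by
    intro w hw
    have hw0 : (0 : ℝ) < w := hw
    have e : k * v * (k * w)⁻¹ = v * w⁻¹ := by field_simp
    have i1 : 1 < k * w ↔ k⁻¹ < w := by rw [inv_lt_iff_one_lt_mul₀' hk0]
    rw [levyKernel, levyKernel, e]
    simp only [Set.indicator, Set.mem_Ioc, i1]
    by_cases hw1 : 1 < w
    · have : k⁻¹ < w := (inv_le_one_of_one_le₀ hk).trans_lt hw1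
      simp [hw1, this, hw1.not_ge]
    · simp only [hw1, if_false, not_lt.1 hw1, and_true, sub_zero]
  have hsub : Set.Ioc k⁻¹ 1 ⊆ Set.Ioi (0 : ℝ) := fun w hw =>
    (inv_pos.2 hk0).trans hw.1
  have hcont : ContinuousOn (fun w : ℝ => Complex.I * ((v * w⁻¹ : ℝ) : ℂ)) (Set.Icc k⁻¹ 1) := by
    refine continuousOn_const.mul (Complex.continuous_ofReal.comp_continuousOn
      (continuousOn_const.mul (continuousOn_inv₀.mono fun w hw => ?_)))
    exact ((inv_pos.2 hk0).trans_le hw.1).ne'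
  have hint : IntegrableOn (fun w : ℝ => Complex.I * ((v * w⁻¹ : ℝ) : ℂ)) (Set.Ioc k⁻¹ 1) :=
    (hcont.integrableOn_Icc).mono_set Set.Ioc_subset_Icc_self
  rw [h2, setIntegral_congr_fun measurableSet_Ioi h3, integral_sub (integrableOn_levyKernel v)
    ((integrable_indicator_iff measurableSet_Ioc).2 hint).integrableOn,
    setIntegral_indicator measurableSet_Ioc, Set.inter_eq_self_of_subset_right hsub,
    integral_const_mul, integral_complex_ofReal, integral_const_mul,
    ← intervalIntegral.integral_of_le (inv_le_one_of_one_le₀ hk),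
    integral_inv_of_pos (inv_pos.2 hk0) one_pos, ← stableExponent_eq_integral]
  rw [one_div, inv_inv]
  push_cast
  ring

/-! ### Asymptotics of the truncated mean -/

/-- The truncated mean `𝔼(ℰ⁻¹; ℰ⁻¹ < N)` of the inverse of an exponential variable. -/
def truncatedMean (N : ℕ) : ℝ := ∫ y in {y : ℝ | y⁻¹ < (N : ℝ)}, y⁻¹ ∂(expMeasure 1)

lemma centering_eq (N : ℕ) : centering N = N * truncatedMean N := rfl

lemma truncatedMean_eq {N : ℕ} (hN : 0 < N) :
    truncatedMean N = ∫ y in Set.Ioi (N : ℝ)⁻¹, Real.exp (-y) * y⁻¹ := by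
  have hN' : (0 : ℝ) < N := by exact_mod_cast hN
  have hm : MeasurableSet {y : ℝ | y⁻¹ < (N : ℝ)} :=
    measurableSet_lt (by fun_prop) (by fun_prop)
  rw [truncatedMean, ← integral_indicator hm, integral_expMeasure_one,
    ← integral_indicator measurableSet_Ioi, ← integral_indicator measurableSet_Ioi]
  congr 1
  ext y
  simp only [Set.indicator, Set.mem_Ioi, Set.mem_ofPred_eq, smul_eq_mul]
  by_cases hy : 0 < y
  · simp only [hy, if_true, inv_lt_comm₀ hy hN']
    split_ifs <;> simp
  · rw [if_neg hy, if_neg]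
    have := inv_pos.2 hN'
    linarith

lemma integrableOn_exp_neg_mul_inv {c : ℝ} (hc : 0 < c) :
    IntegrableOn (fun y : ℝ => Real.exp (-y) * y⁻¹) (Set.Ioi c) := by
  refine Integrable.mono' (g := fun y => c⁻¹ * Real.exp (-y))
    ((integrableOn_exp_neg_Ioi c).const_mul _) (by fun_prop) ?_
  refine (ae_restrict_iff' measurableSet_Ioi).2 (Eventually.of_forall fun y hy => ?_)
  have hy' : c < y := hy
  have : 0 < y := hc.trans hy'
  rw [Real.norm_of_nonneg (by positivity), mul_comm]
  gcongr

/-- On `(1/N, 1]` the bounds `1 - y ≤ exp (-y) ≤ 1` give `log N` up to an error of at most `1`; the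
part beyond `1` lies in `[0, 1]`. -/
lemma truncatedMean_bounds {N : ℕ} (hN : 0 < N) :
    Real.log N - 1 ≤ truncatedMean N ∧ truncatedMean N ≤ Real.log N + 1 := by
  have hN' : (1 : ℝ) ≤ N := by exact_mod_cast hN
  have hN0 : (0 : ℝ) < (N : ℝ)⁻¹ := by positivity
  have hle : (N : ℝ)⁻¹ ≤ 1 := inv_le_one_of_one_le₀ hN'
  have hint := integrableOn_exp_neg_mul_inv hN0
  have hinv : IntegrableOn (fun y : ℝ => y⁻¹) (Set.Ioc (N : ℝ)⁻¹ 1) := by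
    refine ContinuousOn.integrableOn_Icc (μ := volume) (continuousOn_inv₀.mono ?_) |>.mono_set
      Set.Ioc_subset_Icc_self
    exact fun w hw => (hN0.trans_le hw.1).ne'
  have hlog : ∫ y in Set.Ioc (N : ℝ)⁻¹ 1, y⁻¹ = Real.log N := by
    rw [← intervalIntegral.integral_of_le hle, integral_inv_of_pos hN0 one_pos, one_div, inv_inv]
  rw [truncatedMean_eq hN, ← Set.Ioc_union_Ioi_eq_Ioi hle,
    setIntegral_union (Set.Ioc_disjoint_Ioi le_rfl) measurableSet_Ioi
      (hint.mono_set Set.Ioc_subset_Ioi_self) (hint.mono_set (Set.Ioi_subset_Ioi hle))]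
  have h1 : 0 ≤ ∫ y in Set.Ioi (1 : ℝ), Real.exp (-y) * y⁻¹ :=
    setIntegral_nonneg measurableSet_Ioi fun y hy => by
      have : (0 : ℝ) < y := zero_lt_one.trans hy
      positivity
  have h2 : ∫ y in Set.Ioi (1 : ℝ), Real.exp (-y) * y⁻¹ ≤ 1 := by
    calc ∫ y in Set.Ioi (1 : ℝ), Real.exp (-y) * y⁻¹
        ≤ ∫ y in Set.Ioi (1 : ℝ), Real.exp (-y) := by
          refine setIntegral_mono_on (hint.mono_set (Set.Ioi_subset_Ioi hle))
            (integrableOn_exp_neg_Ioi 1) measurableSet_Ioi fun y hy => ?_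
          exact mul_le_of_le_one_right (Real.exp_pos _).le
            (inv_le_one_of_one_le₀ (le_of_lt hy))
      _ = Real.exp (-1) := integral_exp_neg_Ioi 1
      _ ≤ 1 := by simp
  have h3 : ∫ y in Set.Ioc (N : ℝ)⁻¹ 1, Real.exp (-y) * y⁻¹ ≤ Real.log N := by
    rw [← hlog]
    refine setIntegral_mono_on (hint.mono_set Set.Ioc_subset_Ioi_self) hinv measurableSet_Ioc
      fun y hy => ?_
    have : 0 < y := hN0.trans hy.1
    exact mul_le_of_le_one_left (by positivity) (by simp [this.le])
  have h4 : Real.log N - 1 ≤ ∫ y in Set.Ioc (N : ℝ)⁻¹ 1, Real.exp (-y) * y⁻¹ := by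
    calc Real.log N - 1 ≤ Real.log N - ∫ y in Set.Ioc (N : ℝ)⁻¹ 1, (1 : ℝ) := by
          simp only [integral_const, measureReal_restrict_apply_univ, Real.volume_real_Ioc_of_le hle,
            smul_eq_mul, mul_one]
          linarith
      _ = ∫ y in Set.Ioc (N : ℝ)⁻¹ 1, (y⁻¹ - 1) := by
          rw [← hlog, integral_sub hinv (by simp)]
      _ ≤ _ := by
          refine setIntegral_mono_on (hinv.sub (by simp))
            (hint.mono_set Set.Ioc_subset_Ioi_self) measurableSet_Ioc fun y hy => ?_
          have : 0 < y := hN0.trans hy.1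
          have h := mul_le_mul_of_nonneg_right (Real.one_sub_le_exp_neg y) (inv_pos.2 this).le
          rwa [sub_mul, one_mul, mul_inv_cancel₀ this.ne'] at h
  constructor <;> linarith

lemma tendsto_log_natCast_atTop : Tendsto (fun N : ℕ => Real.log N) atTop atTop :=
  Real.tendsto_log_atTop.comp tendsto_natCast_atTop_atTop

lemma tendsto_truncatedMean_div_log :
    Tendsto (fun N : ℕ => truncatedMean N / Real.log N) atTop (𝓝 1) := by
  have hinv : Tendsto (fun N : ℕ => (Real.log N)⁻¹) atTop (𝓝 0) :=
    tendsto_inv_atTop_zero.comp tendsto_log_natCast_atTop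
  have hl : Tendsto (fun N : ℕ => 1 - (Real.log N)⁻¹) atTop (𝓝 1) := by
    simpa using tendsto_const_nhds.sub hinv
  have hu : Tendsto (fun N : ℕ => 1 + (Real.log N)⁻¹) atTop (𝓝 1) := by
    simpa using tendsto_const_nhds.add hinv
  refine tendsto_of_tendsto_of_tendsto_of_le_of_le' hl hu ?_ ?_
  all_goals
    filter_upwards [tendsto_log_natCast_atTop.eventually_gt_atTop 0, eventually_gt_atTop 0]
      with N hlog hN
    obtain ⟨h1, h2⟩ := truncatedMean_bounds hN
  · rw [le_div_iff₀ hlog, sub_mul, inv_mul_cancel₀ hlog.ne']; linarith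
  · rw [div_le_iff₀ hlog, add_mul, inv_mul_cancel₀ hlog.ne']; linarith

/-- This makes the quadratic error from centring the `N` factors negligible. -/
lemma tendsto_truncatedMean_sq_div :
    Tendsto (fun N : ℕ => truncatedMean N ^ 2 / N) atTop (𝓝 0) := by
  have h1 : Tendsto (fun N : ℕ => Real.log N ^ 2 / N) atTop (𝓝 0) :=
    ((Real.isLittleO_pow_log_id_atTop (n := 2)).tendsto_div_nhds_zero).comp
      tendsto_natCast_atTop_atTop
  have h2 := (tendsto_truncatedMean_div_log.pow 2).mul h1
  rw [mul_zero] at h2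
  refine h2.congr' ?_
  filter_upwards [tendsto_log_natCast_atTop.eventually_gt_atTop 0] with N hlog
  field_simp

/-! ### Convergence of characteristic functions to the stable law -/

/-- The characteristic function of `(N ℰ)⁻¹`. -/
def invExpCharFun (N : ℕ) (v : ℝ) : ℂ :=
  ∫ y, Complex.exp (Complex.I * (v * ((N : ℝ) * y)⁻¹ : ℝ)) ∂(expMeasure 1)

/-- Integrating `levyKernel v (N ℰ)` and rescaling `w = N y` turns the density `exp (-y)` into `exp
(-w / N)`. The compensation range `1 < N y` is exactly the truncation `y⁻¹ < N` in `b_N`. -/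
lemma integral_levyKernel_expMeasure {N : ℕ} (hN : 0 < N) (v : ℝ) :
    N * (invExpCharFun N v - 1) - Complex.I * (v * truncatedMean N : ℝ)
      = ∫ w in Set.Ioi (0 : ℝ), Real.exp (-(w * (N : ℝ)⁻¹)) • levyKernel v w := by
  have hN' : (0 : ℝ) < N := by exact_mod_cast hN
  have hm : MeasurableSet {y : ℝ | y⁻¹ < (N : ℝ)} :=
    measurableSet_lt (by fun_prop) (by fun_prop)
  have hbound : Integrable (fun y => Complex.exp (Complex.I * (v * ((N : ℝ) * y)⁻¹ : ℝ)))
      (expMeasure 1) := by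
    refine Integrable.of_bound (by fun_prop) 1 (Eventually.of_forall fun y => ?_)
    rw [Complex.norm_exp_I_mul_ofReal]
  have hind : Integrable ({y : ℝ | y⁻¹ < (N : ℝ)}.indicator fun y => y⁻¹) (expMeasure 1) := by
    refine Integrable.of_bound (Measurable.aestronglyMeasurable
      (Measurable.indicator (by fun_prop) hm)) N ?_
    filter_upwards [ae_pos_expMeasure_one] with y hy
    rw [Set.indicator]
    split_ifs with h
    · rw [Real.norm_of_nonneg (inv_pos.2 hy).le]; exact le_of_lt h
    · simp
  have h1 : ∫ y, levyKernel v (N * y) ∂(expMeasure 1) = invExpCharFun N v - 1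
      - Complex.I * ((v * (N : ℝ)⁻¹ : ℝ) : ℂ) * (truncatedMean N : ℂ) := by
    have e : levyKernel v ∘ (fun y => N * y) =ᵐ[expMeasure 1] fun y =>
        (Complex.exp (Complex.I * (v * ((N : ℝ) * y)⁻¹ : ℝ)) - 1)
        - Complex.I * ((v * (N : ℝ)⁻¹ : ℝ) : ℂ)
          * (({y : ℝ | y⁻¹ < (N : ℝ)}.indicator (fun y => y⁻¹) y : ℝ) : ℂ) := by
      filter_upwards [ae_pos_expMeasure_one] with y hy
      have : 1 < N * y ↔ y⁻¹ < (N : ℝ) := by rw [inv_lt_iff_one_lt_mul₀ hy]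
      simp only [Function.comp, levyKernel, Set.indicator, Set.mem_ofPred_eq, this]
      split_ifs
      · push_cast; rw [mul_inv]; ring
      · simp
    have hind' : Integrable (fun y => Complex.I * ((v * (N : ℝ)⁻¹ : ℝ) : ℂ)
          * (({y : ℝ | y⁻¹ < (N : ℝ)}.indicator (fun y => y⁻¹) y : ℝ) : ℂ)) (expMeasure 1) :=
      (hind.ofReal (𝕜 := ℂ)).const_mul _
    rw [show (∫ y, levyKernel v (N * y) ∂(expMeasure 1))
        = ∫ y, (levyKernel v ∘ (fun y => N * y)) y ∂(expMeasure 1) from rfl, integral_congr_ae e,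
      integral_sub (f := fun y => Complex.exp (Complex.I * (v * ((N : ℝ) * y)⁻¹ : ℝ)) - 1)
        (hbound.sub (integrable_const _)) hind',
      integral_sub hbound (integrable_const _), integral_const_mul, integral_complex_ofReal,
      integral_indicator hm]
    simp [invExpCharFun, truncatedMean]
  have h2 : ∫ y, levyKernel v (N * y) ∂(expMeasure 1)
      = (N : ℂ)⁻¹ * ∫ w in Set.Ioi (0 : ℝ), Real.exp (-(w * (N : ℝ)⁻¹)) • levyKernel v w := by
    rw [integral_expMeasure_one]
    have := integral_comp_mul_left_Ioi
      (fun w => Real.exp (-(w * (N : ℝ)⁻¹)) • levyKernel v w) 0 hN'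
    rw [mul_zero, Complex.real_smul] at this
    push_cast at this
    rw [← this]
    refine setIntegral_congr_fun measurableSet_Ioi fun y _ => ?_
    have : N * y * (N : ℝ)⁻¹ = y := by field_simp
    simp only [this]
  have hNc : (N : ℂ) ≠ 0 := by exact_mod_cast hN.ne'
  have h3 := h1.symm.trans h2
  rw [eq_inv_mul_iff_mul_eq₀ hNc] at h3
  rw [← h3]
  push_cast
  field_simp

lemma tendsto_invExpCharFun (v : ℝ) :
    Tendsto (fun N : ℕ => N * (invExpCharFun N v - 1) - Complex.I * (v * truncatedMean N : ℝ))
      atTop (𝓝 (stableExponent v)) := by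
  rw [stableExponent_eq_integral]
  have h : Tendsto (fun N : ℕ => ∫ w in Set.Ioi (0 : ℝ),
      Real.exp (-(w * (N : ℝ)⁻¹)) • levyKernel v w) atTop
      (𝓝 (∫ w in Set.Ioi (0 : ℝ), levyKernel v w)) := by
    refine tendsto_integral_of_dominated_convergence (fun w => ‖levyKernel v w‖)
      (fun N => by fun_prop) (integrableOn_levyKernel v).norm (fun N => ?_) ?_
    · refine (ae_restrict_iff' measurableSet_Ioi).2 (Eventually.of_forall fun w hw => ?_)
      rw [norm_smul, Real.norm_of_nonneg (Real.exp_pos _).le]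
      refine mul_le_of_le_one_left (norm_nonneg _) (Real.exp_le_one_iff.2 ?_)
      have : (0 : ℝ) < w := hw
      simp only [Left.neg_nonpos_iff]
      positivity
    · refine Eventually.of_forall fun w => ?_
      have : Tendsto (fun N : ℕ => Real.exp (-(w * (N : ℝ)⁻¹))) atTop (𝓝 1) := by
        have := ((tendsto_inv_atTop_zero.comp
          (tendsto_natCast_atTop_atTop (R := ℝ))).const_mul w).neg
        simpa [Function.comp_def] using (Real.continuous_exp.tendsto _).comp this
      simpa using this.smul_const (levyKernel v w)
  refine h.congr' ?_
  filter_upwards [eventually_gt_atTop 0] with N hN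
  rw [integral_levyKernel_expMeasure hN]

/-- With `α = -v m_N / N` and `χ = invExpCharFun N v`, the quantity `N (exp (iα) χ - 1)` is the sum
of `N (exp (iα) - 1 - iα)`, of `N (χ - 1) + i N α`, which tends to the exponent, and of `(exp (iα) -
1) N (χ - 1)`. The other two terms vanish because `N α² → 0`. -/
lemma tendsto_exp_mul_invExpCharFun_pow (v : ℝ) :
    Tendsto (fun N : ℕ => (Complex.exp (Complex.I * (-(v * truncatedMean N / N) : ℝ))
      * invExpCharFun N v) ^ N) atTop (𝓝 (Complex.exp (stableExponent v))) := by
  set α : ℕ → ℝ := fun N => -(v * truncatedMean N / N) with hα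
  have hα2 : Tendsto (fun N : ℕ => N * α N ^ 2) atTop (𝓝 0) := by
    have := tendsto_truncatedMean_sq_div.const_mul (v ^ 2)
    rw [mul_zero] at this
    refine this.congr' ?_
    filter_upwards [eventually_gt_atTop 0] with N hN
    have hN' : (N : ℝ) ≠ 0 := by exact_mod_cast hN.ne'
    simp only [hα]
    field_simp
  have hα1 : Tendsto α atTop (𝓝 0) := by
    have : Tendsto (fun N => α N ^ 2) atTop (𝓝 0) := by
      refine squeeze_zero' (Eventually.of_forall fun N => sq_nonneg _) ?_ hα2
      filter_upwards [eventually_gt_atTop 0] with N hN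
      have : (1 : ℝ) ≤ N := by exact_mod_cast hN
      nlinarith [sq_nonneg (α N)]
    have h2 := this.sqrt
    simp only [Real.sqrt_sq_eq_abs, Real.sqrt_zero] at h2
    exact (tendsto_zero_iff_abs_tendsto_zero _).2 h2
  have hexp : Tendsto (fun N => Complex.exp (Complex.I * α N) - 1) atTop (𝓝 0) := by
    have : Tendsto (fun N => Complex.exp (Complex.I * α N) - 1) atTop
        (𝓝 (Complex.exp (Complex.I * (0 : ℝ)) - 1)) :=
      ((Complex.continuous_exp.tendsto _).comp
        ((Complex.continuous_ofReal.tendsto _).comp hα1 |>.const_mul _)).sub_const 1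
    simpa using this
  have hA : Tendsto (fun N : ℕ => (N : ℂ) * (Complex.exp (Complex.I * α N) - 1
      - Complex.I * α N)) atTop (𝓝 0) := by
    refine squeeze_zero_norm (a := fun N : ℕ => 3 * (N * α N ^ 2)) (fun N => ?_)
      (by simpa using hα2.const_mul 3)
    rw [norm_mul, Complex.norm_natCast]
    have := mul_le_mul_of_nonneg_left (norm_exp_I_mul_sub_one_sub_le (α N)) (Nat.cast_nonneg (α := ℝ) N)
    linarith
  have hB : Tendsto (fun N : ℕ => (Complex.exp (Complex.I * α N) - 1)
      * (N * (Complex.I * α N))) atTop (𝓝 0) := by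
    refine squeeze_zero_norm (a := fun N : ℕ => N * α N ^ 2) (fun N => ?_) hα2
    rw [norm_mul, norm_mul, norm_mul, Complex.norm_natCast, Complex.norm_I, one_mul,
      Complex.norm_real, Real.norm_eq_abs]
    have h1 := Real.norm_exp_I_mul_ofReal_sub_one_le (x := α N)
    rw [Real.norm_eq_abs] at h1
    have h2 := mul_le_mul_of_nonneg_right h1
      (mul_nonneg (Nat.cast_nonneg (α := ℝ) N) (abs_nonneg (α N)))
    refine h2.trans (le_of_eq ?_)
    rw [← sq_abs]; ring
  have hpsi := tendsto_invExpCharFun v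
  have hsum := (hA.add hpsi).add ((hexp.mul hpsi).sub hB)
  rw [zero_mul, sub_zero, zero_add, add_zero] at hsum
  have key := Complex.tendsto_one_add_pow_exp_of_tendsto
    (g := fun N : ℕ => Complex.exp (Complex.I * α N) * invExpCharFun N v - 1)
    (t := stableExponent v) (hsum.congr' ?_)
  · simpa only [add_sub_cancel] using key
  · filter_upwards [eventually_gt_atTop 0] with N hN
    have hNc : (N : ℂ) ≠ 0 := by exact_mod_cast hN.ne'
    have : Complex.I * ((v * truncatedMean N : ℝ) : ℂ) = - (N * (Complex.I * α N)) := by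
      simp only [hα]; push_cast; field_simp
    rw [this]
    ring

/-! ### Tools of weak convergence -/

section WeakConvergence

variable {Ω Ω' : Type*} [MeasurableSpace Ω] [MeasurableSpace Ω'] {P : Measure Ω}
  [IsProbabilityMeasure P] {P' : Measure Ω'} [IsProbabilityMeasure P']

lemma tendstoInDistribution_iff_charFun {X : ℕ → Ω → ℝ} {Z : Ω' → ℝ}
    (hX : ∀ n, AEMeasurable (X n) P) (hZ : AEMeasurable Z P') :
    TendstoInDistribution X atTop Z (fun _ => P) P' ↔
      ∀ v, Tendsto (fun n => charFun (P.map (X n)) v) atTop (𝓝 (charFun (P'.map Z) v)) := by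
  constructor
  · intro h
    exact ProbabilityMeasure.tendsto_iff_tendsto_charFun.1 h.tendsto
  · intro h
    exact ⟨hX, hZ, ProbabilityMeasure.tendsto_iff_tendsto_charFun.2 h⟩

/-- A sequence that converges in distribution is tight. -/
lemma MeasureTheory.TendstoInDistribution.exists_isCompact_measure_notMem_le {X : ℕ → Ω → ℝ}
    {Z : Ω' → ℝ} (h : TendstoInDistribution X atTop Z (fun _ => P) P') {ε : ENNReal}
    (hε : 0 < ε) : ∃ K : Set ℝ, IsCompact K ∧ ∀ n, P {ω | X n ω ∉ K} ≤ ε := by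
  have hX := h.forall_aemeasurable
  have hprob : ∀ n, IsProbabilityMeasure (P.map (X n)) :=
    fun n => Measure.isProbabilityMeasure_map (hX n)
  have := Measure.isProbabilityMeasure_map h.aemeasurable_limit
  have ht := isTightMeasureSet_of_tendsto_charFun (μ := fun n => P.map (X n))
    (f := charFun (P'.map Z)) (by fun_prop)
    ((tendstoInDistribution_iff_charFun hX h.aemeasurable_limit).1 h)
  obtain ⟨K, hK, hle⟩ := isTightMeasureSet_iff_exists_isCompact_measure_compl_le.1 ht ε hε
  refine ⟨K, hK, fun n => ?_⟩
  have := hle _ ⟨n, rfl⟩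
  rwa [Measure.map_apply_of_aemeasurable (hX n) hK.measurableSet.compl] at this

/-- The extended continuous mapping theorem: the maps may depend on `n`, provided that they
converge uniformly on compact sets. -/
lemma MeasureTheory.TendstoInDistribution.comp_tendstoUniformlyOn {X : ℕ → Ω → ℝ}
    {Z : Ω' → ℝ} (h : TendstoInDistribution X atTop Z (fun _ => P) P') {g : ℕ → ℝ → ℝ}
    {g' : ℝ → ℝ} (hg : ∀ n, Measurable (g n)) (hg' : Continuous g')
    (hlim : ∀ K : Set ℝ, IsCompact K → TendstoUniformlyOn g g' atTop K) :
    TendstoInDistribution (fun n ω => g n (X n ω)) atTop (fun z => g' (Z z)) (fun _ => P) P' := by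
  -- By Slutsky it suffices that `g n (X n) - g' (X n)` tends to `0` in probability; tightness
  -- confines `X n` to a compact set up to probability `δ`.
  refine tendstoInDistribution_of_tendstoInMeasure_sub _ _ (h.continuous_comp hg') ?_
    fun n => (hg n).comp_aemeasurable (h.forall_aemeasurable n)
  rw [tendstoInMeasure_iff_norm]
  intro ε hε
  rw [ENNReal.tendsto_nhds_zero]
  intro δ hδ
  obtain ⟨K, hK, hle⟩ := h.exists_isCompact_measure_notMem_le hδ
  filter_upwards [Metric.tendstoUniformlyOn_iff.1 (hlim K hK) ε hε] with n hn
  refine (measure_mono fun ω hω => ?_).trans (hle n)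
  intro hmem
  have := hn _ hmem
  rw [dist_comm, Real.dist_eq] at this
  simp only [Set.mem_ofPred_eq, Pi.sub_apply, Function.comp, Pi.zero_apply, sub_zero,
    Real.norm_eq_abs] at hω
  linarith

/-- A pointwise limit of characteristic functions that is continuous at `0` is a characteristic
function. -/
lemma exists_charFun_eq_of_tendsto {μ : ℕ → ProbabilityMeasure ℝ} {f : ℝ → ℂ}
    (hf : ContinuousAt f 0)
    (h : ∀ v, Tendsto (fun n => charFun (μ n : Measure ℝ) v) atTop (𝓝 (f v))) :
    ∃ S : ProbabilityMeasure ℝ, ∀ v, charFun (S : Measure ℝ) v = f v := by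
  have ht : IsTightMeasureSet (Set.range fun n => (μ n : Measure ℝ)) :=
    isTightMeasureSet_of_tendsto_charFun hf h
  have hc : IsCompact (closure (Set.range μ)) :=
    isCompact_closure_of_isTightMeasureSet (ht.subset (by rintro _ ⟨_, ⟨n, rfl⟩, rfl⟩; exact ⟨n, rfl⟩))
  -- Prokhorov's theorem gives a limit along an ultrafilter; this is enough, since the
  -- characteristic functions converge along the whole sequence.
  obtain ⟨S, -, hS : Tendsto _ _ _⟩ := hc.ultrafilter_le_nhds ((hyperfilter ℕ).map μ)
    (.trans (by simp) (monotone_principal subset_closure))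
  refine ⟨S, fun v => ?_⟩
  rw [ProbabilityMeasure.tendsto_iff_forall_integral_rclike_tendsto ℂ] at hS
  have h1 := hS (BoundedContinuousFunction.innerProbChar v)
  have h2 := (h v).mono_left Nat.hyperfilter_le_atTop
  simp_rw [charFun_eq_integral_innerProbChar] at h2 ⊢
  exact tendsto_nhds_unique h1 h2

end WeakConvergence

/-! ### Hoeffding's bound and Glivenko-Cantelli -/

section Empirical

variable {a lam : ℝ}

lemma gumbelMeasure_real_Ioi (hlam : 0 < lam) (x : ℝ) :
    (gumbelMeasure a lam).real (Set.Ioi x) = limitProfile a lam x := by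
  rw [← Set.compl_Iic, probReal_compl_eq_one_sub measurableSet_Iic, gumbelMeasure_real_Iic hlam,
    limitProfile]

/-- Hoeffding's inequality for the profile of `N` i.i.d. Gumbel variables. -/
lemma measureReal_abs_frontProfile_sub_ge_le (hlam : 0 < lam) {N : ℕ} (hN : 0 < N) (x : ℝ) {ε : ℝ}
    (hε : 0 ≤ ε) :
    (Measure.pi fun _ : Fin N => gumbelMeasure a lam).real
      {r | ε ≤ |frontProfile r x - limitProfile a lam x|} ≤ 2 * Real.exp (-(2 * N * ε ^ 2)) := by
  have hN' : (0 : ℝ) < N := by exact_mod_cast hN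
  set Q := Measure.pi fun _ : Fin N => gumbelMeasure a lam
  set h : ℝ → ℝ := (Set.Ioi x).indicator 1 with hh
  have hm : Measurable h := measurable_one.indicator measurableSet_Ioi
  have hmean : ∀ i, ∫ r : Fin N → ℝ, h (r i) ∂Q = limitProfile a lam x := by
    intro i
    rw [← gumbelMeasure_real_Ioi hlam, ← integral_indicator_one measurableSet_Ioi,
      ← (measurePreserving_eval (fun _ : Fin N => gumbelMeasure a lam) i).map_eq,
      integral_map (measurable_pi_apply i).aemeasurable hm.aestronglyMeasurable]
  have hsub : ∀ i, HasSubgaussianMGF (fun r : Fin N → ℝ => h (r i) - limitProfile a lam x)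
      ((‖(1 : ℝ) - 0‖₊ / 2) ^ 2) Q := by
    intro i
    have := hasSubgaussianMGF_of_mem_Icc (μ := Q) (X := fun r : Fin N → ℝ => h (r i)) (a := 0)
      (b := 1) (hm.comp (measurable_pi_apply i)).aemeasurable (Eventually.of_forall fun r => by
        simp only [hh, Set.indicator]; split_ifs <;> simp)
    rwa [hmean i] at this
  have hindep : iIndepFun (fun i (r : Fin N → ℝ) => h (r i) - limitProfile a lam x) Q :=
    iIndepFun_pi (X := fun _ y => h y - limitProfile a lam x) fun i => by fun_prop
  have hindep' : iIndepFun (fun i (r : Fin N → ℝ) => -(h (r i) - limitProfile a lam x)) Q :=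
    iIndepFun_pi (X := fun _ y => -(h y - limitProfile a lam x)) fun i => by fun_prop
  have hprof : ∀ r : Fin N → ℝ, ∑ i, (h (r i) - limitProfile a lam x)
      = N * (frontProfile r x - limitProfile a lam x) := by
    intro r
    rw [Finset.sum_sub_distrib, frontProfile, mul_sub, mul_inv_cancel_left₀ hN'.ne']
    simp [hh, Set.indicator]
  have h1 := HasSubgaussianMGF.measure_sum_ge_le_of_iIndepFun hindep (s := Finset.univ)
    (fun i _ => hsub i) (ε := N * ε) (by positivity)
  have h2 := HasSubgaussianMGF.measure_sum_ge_le_of_iIndepFun hindep' (s := Finset.univ)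
    (fun i _ => (hsub i).neg) (ε := N * ε) (by positivity)
  -- Variables in `[0, 1]` have sub-Gaussian parameter `1/4`, so the variance proxy of the sum is `N
  -- / 4`.
  have hexp : -(N * ε) ^ 2 / (2 * ((∑ _i : Fin N, (‖(1 : ℝ) - 0‖₊ / 2) ^ 2 : NNReal) : ℝ))
      = -(2 * N * ε ^ 2) := by
    simp
    field_simp
  push_cast at h1 h2 hexp
  rw [hexp] at h1 h2
  have hsubset : {r : Fin N → ℝ | ε ≤ |frontProfile r x - limitProfile a lam x|}
      ⊆ {r | N * ε ≤ ∑ i, (h (r i) - limitProfile a lam x)}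
        ∪ {r | N * ε ≤ ∑ i, -(h (r i) - limitProfile a lam x)} := by
    intro r hr
    simp only [Set.mem_union, Set.mem_ofPred_eq, Finset.sum_neg_distrib, hprof] at hr ⊢
    rcases le_abs.1 hr with h | h
    · left; exact mul_le_mul_of_nonneg_left h hN'.le
    · right
      rw [← mul_neg]
      exact mul_le_mul_of_nonneg_left h hN'.le
  calc Q.real _ ≤ Q.real _ := measureReal_mono hsubset
    _ ≤ _ := measureReal_union_le _ _
    _ ≤ _ := by linarith

lemma frontProfile_antitone {N : ℕ} (y : Fin N → ℝ) : Antitone (frontProfile y) := by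
  intro x x' hx
  unfold frontProfile
  gcongr with i
  split_ifs with h1 h2 <;> linarith

lemma frontProfile_nonneg {N : ℕ} (y : Fin N → ℝ) (x : ℝ) : 0 ≤ frontProfile y x := by
  unfold frontProfile
  exact mul_nonneg (by positivity) (Finset.sum_nonneg fun i _ => by split_ifs <;> norm_num)

lemma frontProfile_le_one {N : ℕ} (y : Fin N → ℝ) (x : ℝ) : frontProfile y x ≤ 1 := by
  unfold frontProfile
  calc (N : ℝ)⁻¹ * ∑ i, (if x < y i then (1 : ℝ) else 0) ≤ (N : ℝ)⁻¹ * ∑ _i : Fin N, (1 : ℝ) := by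
        gcongr with i
        split_ifs <;> norm_num
    _ ≤ 1 := by simpa using inv_mul_le_one

/-- Pólya's theorem: the pointwise convergence on a dense set of `[0, 1]`-valued antitone functions
to a continuous function with the limits `1` and `0` at infinity is uniform. -/
lemma tendstoUniformly_of_antitone {F : ℕ → ℝ → ℝ} {u : ℝ → ℝ} (hF : ∀ n, Antitone (F n))
    (h0 : ∀ n x, 0 ≤ F n x) (h1 : ∀ n x, F n x ≤ 1) (hu : Continuous u) (hu' : Antitone u)
    (hbot : Tendsto u atBot (𝓝 1)) (htop : Tendsto u atTop (𝓝 0))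
    (hlim : ∀ q : ℚ, Tendsto (fun n => F n q) atTop (𝓝 (u q))) :
    TendstoUniformly F u atTop := by
  have hloc : TendstoLocallyUniformly F u atTop := by
    rw [Metric.tendstoLocallyUniformly_iff]
    intro ε hε y
    have hy := Metric.continuousAt_iff.1 (hu.continuousAt (x := y)) (ε / 4) (by positivity)
    obtain ⟨δ, hδ, hy⟩ := hy
    -- Between two rationals close to `y`, monotonicity squeezes both functions; the errors add up
    -- to less than `ε`.
    obtain ⟨p, hp1, hp2⟩ := exists_rat_btwn (show y - δ < y by linarith)
    obtain ⟨q, hq1, hq2⟩ := exists_rat_btwn (show y < y + δ by linarith)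
    have hup := hy (x := p) (by rw [Real.dist_eq, abs_lt]; constructor <;> linarith)
    have huq := hy (x := q) (by rw [Real.dist_eq, abs_lt]; constructor <;> linarith)
    rw [Real.dist_eq, abs_lt] at hup huq
    refine ⟨Set.Ioo p q, Ioo_mem_nhds hp2 hq1, ?_⟩
    filter_upwards [Metric.tendsto_nhds.1 (hlim p) (ε / 4) (by positivity),
      Metric.tendsto_nhds.1 (hlim q) (ε / 4) (by positivity)] with n hnp hnq x hx
    rw [Real.dist_eq, abs_lt] at hnp hnq ⊢
    have := hF n hx.1.le
    have := hF n hx.2.le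
    have := hu' hx.1.le
    have := hu' hx.2.le
    constructor <;> linarith
  rw [Metric.tendstoUniformly_iff]
  intro ε hε
  have hb := (Metric.tendsto_nhds.1 hbot (ε / 2) (by positivity))
  have ht := (Metric.tendsto_nhds.1 htop (ε / 2) (by positivity))
  obtain ⟨A', hA'⟩ := hb.exists_forall_of_atBot
  obtain ⟨B', hB'⟩ := ht.exists_forall_of_atTop
  -- The cut-offs are rational because convergence is known only there; beyond them monotonicity and
  -- the bounds `0` and `1` give the estimate.
  obtain ⟨A, hA⟩ := exists_rat_lt A'
  obtain ⟨B, hB⟩ := exists_rat_gt B'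
  have hcpt := (tendstoLocallyUniformlyOn_iff_tendstoUniformlyOn_of_compact
    (isCompact_Icc (a := (A : ℝ)) (b := B))).1 hloc.tendstoLocallyUniformlyOn
  have hAu := hA' A hA.le
  have hBu := hB' B hB.le
  rw [Real.dist_eq, abs_lt] at hAu hBu
  have hu1 : ∀ x, u x ≤ 1 := fun x => hu'.ge_of_tendsto hbot x
  have hu0 : ∀ x, 0 ≤ u x := fun x => hu'.le_of_tendsto htop x
  filter_upwards [Metric.tendstoUniformlyOn_iff.1 hcpt ε hε,
    Metric.tendsto_nhds.1 (hlim A) (ε / 2) (by positivity),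
    Metric.tendsto_nhds.1 (hlim B) (ε / 2) (by positivity)] with n hn hnA hnB x
  rw [Real.dist_eq, abs_lt] at hnA hnB
  rcases lt_or_ge x (A : ℝ) with hx | hx
  · rw [Real.dist_eq, abs_lt]
    have := hF n hx.le
    have := hu' hx.le
    have := h1 n x
    have := hu1 x
    constructor <;> linarith
  rcases lt_or_ge (B : ℝ) x with hx' | hx'
  · rw [Real.dist_eq, abs_lt]
    have := hF n hx'.le
    have := hu' hx'.le
    have := h0 n x
    have := hu0 x
    constructor <;> linarith
  · exact hn x ⟨hx, hx'⟩

lemma continuous_limitProfile (a lam : ℝ) : Continuous (limitProfile a lam) := by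
  unfold limitProfile; fun_prop

lemma limitProfile_antitone (hlam : 0 < lam) : Antitone (limitProfile a lam) := by
  intro x x' h
  unfold limitProfile
  gcongr

lemma tendsto_limitProfile_atTop (hlam : 0 < lam) :
    Tendsto (limitProfile a lam) atTop (𝓝 0) := by
  unfold limitProfile
  have h1 : Tendsto (fun x => -(lam * (x - a))) atTop atBot :=
    tendsto_neg_atTop_atBot.comp
      ((tendsto_atTop_add_const_right atTop (-a) tendsto_id).const_mul_atTop hlam)
  have h2 := (Real.continuous_exp.tendsto _).comp (Real.tendsto_exp_atBot.comp h1).neg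
  simpa [Function.comp_def] using h2.const_sub 1

lemma tendsto_limitProfile_atBot (hlam : 0 < lam) :
    Tendsto (limitProfile a lam) atBot (𝓝 1) := by
  unfold limitProfile
  have h1 : Tendsto (fun x => -(lam * (x - a))) atBot atTop :=
    tendsto_neg_atBot_atTop.comp
      ((tendsto_atBot_add_const_right atBot (-a) tendsto_id).const_mul_atBot hlam)
  have h2 := Real.tendsto_exp_atBot.comp
    (tendsto_neg_atTop_atBot.comp (Real.tendsto_exp_atTop.comp h1))
  simpa [Function.comp_def] using h2.const_sub 1

/-- The Glivenko-Cantelli theorem for a triangular array of Gumbel variables. -/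
lemma ae_tendstoUniformly_frontProfile {Ω : Type*} [MeasurableSpace Ω] {P : Measure Ω}
    [IsProbabilityMeasure P] (hlam : 0 < lam) {r : (N : ℕ) → Ω → Fin N → ℝ}
    (hr : ∀ N, Measurable (r N))
    (hlaw : ∀ N, P.map (r N) = Measure.pi fun _ => gumbelMeasure a lam) :
    ∀ᵐ ω ∂P, TendstoUniformly (fun N x => frontProfile (r N ω) x) (limitProfile a lam) atTop := by
  have hpoint : ∀ᵐ ω ∂P, ∀ q : ℚ, ∀ m : ℕ, ∀ᶠ N in atTop,
      ¬ ((m + 1 : ℝ)⁻¹ ≤ |frontProfile (r N ω) q - limitProfile a lam q|) := by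
    rw [ae_all_iff]; intro q
    rw [ae_all_iff]; intro m
    have hε : (0 : ℝ) < (m + 1 : ℝ)⁻¹ := by positivity
    have hsum : Summable fun N : ℕ =>
        (P.real {ω | (m + 1 : ℝ)⁻¹ ≤ |frontProfile (r N ω) q - limitProfile a lam q|}) := by
      have hgeom : Summable fun N : ℕ => 2 * Real.exp (-(2 * N * ((m + 1 : ℝ)⁻¹) ^ 2)) := by
        have := (Real.summable_exp_nat_mul_iff (a := -(2 * ((m + 1 : ℝ)⁻¹) ^ 2))).2
          (by have := sq_pos_of_pos hε; linarith)
        refine (this.mul_left 2).congr fun N => ?_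
        ring_nf
      rw [← summable_nat_add_iff 1] at hgeom ⊢
      refine Summable.of_nonneg_of_le (fun _ => measureReal_nonneg) (fun N => ?_) hgeom
      have hm : MeasurableSet {y : Fin (N + 1) → ℝ |
          (m + 1 : ℝ)⁻¹ ≤ |frontProfile y q - limitProfile a lam q|} :=
        measurableSet_le measurable_const
          ((measurable_frontProfile.comp (measurable_id.prodMk measurable_const)).sub_const _).abs
      have := measureReal_abs_frontProfile_sub_ge_le (a := a) hlam (Nat.succ_pos N) q hε.le
      rw [← hlaw, map_measureReal_apply (hr _) hm] at this
      exact this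
    -- This half of Borel-Cantelli needs no independence between different `N`.
    refine ae_eventually_notMem (s := fun N => {ω | (m + 1 : ℝ)⁻¹
      ≤ |frontProfile (r N ω) q - limitProfile a lam q|}) ?_
    have := hsum.tsum_ofReal_ne_top
    simpa [measureReal_def] using this
  filter_upwards [hpoint] with ω hω
  refine tendstoUniformly_of_antitone (fun N => frontProfile_antitone _)
    (fun N => frontProfile_nonneg _) (fun N => frontProfile_le_one _) (continuous_limitProfile a lam)
    (limitProfile_antitone hlam) (tendsto_limitProfile_atBot hlam)
    (tendsto_limitProfile_atTop hlam) fun q => ?_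
  rw [Metric.tendsto_nhds]
  intro ε hε
  obtain ⟨m, hm⟩ := exists_nat_one_div_lt hε
  filter_upwards [hω q m] with N hN
  rw [Real.dist_eq]
  rw [one_div] at hm
  linarith

end Empirical

/-! ### Stable limit of the front location -/

section StableLimit

/-- The centred and normalized sum of the variables `exp (lam (r_i - a))`. -/
def normalizedSum (a lam : ℝ) {N : ℕ} (r : Fin N → ℝ) : ℝ :=
  ∑ i, (Real.exp (lam * (r i - a)) - truncatedMean N) / N

@[fun_prop]
lemma measurable_normalizedSum (a lam : ℝ) {N : ℕ} :
    Measurable (normalizedSum a lam : (Fin N → ℝ) → ℝ) := by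
  unfold normalizedSum; fun_prop

/-- Writing `r = a - lam⁻¹ log ℰ` gives `exp (lam (r - a)) = 1 / ℰ`; the power comes from
independence and the exponential factor from the centring. -/
lemma charFun_map_normalizedSum {a lam : ℝ} (hlam : 0 < lam) {N : ℕ} (v : ℝ) :
    charFun ((Measure.pi fun _ : Fin N => gumbelMeasure a lam).map (normalizedSum a lam)) v
      = (Complex.exp (Complex.I * (-(v * truncatedMean N / N) : ℝ)) * invExpCharFun N v) ^ N := by
  set h : ℝ → ℝ := fun y => (Real.exp (lam * (y - a)) - truncatedMean N) / N with hh
  have hm : Measurable h := by fun_prop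
  have := Measure.isProbabilityMeasure_map (μ := gumbelMeasure a lam) hm.aemeasurable
  have e : (normalizedSum a lam : (Fin N → ℝ) → ℝ)
      = (fun p => ∑ i, p i) ∘ (fun (r : Fin N → ℝ) i => h (r i)) := rfl
  rw [e, ← Measure.map_map (by fun_prop) (by fun_prop),
    Measure.pi_map_pi (f := fun _ => h) (fun _ => hm.aemeasurable), charFun_map_sum_pi_eq_prod,
    Finset.prod_const, Finset.card_univ, Fintype.card_fin, Pi.pow_apply]
  congr 1
  rw [charFun_apply_real, integral_map hm.aemeasurable (by fun_prop), gumbelMeasure,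
    integral_map (by fun_prop) (by fun_prop), invExpCharFun, ← integral_const_mul]
  refine integral_congr_ae ?_
  filter_upwards [ae_pos_expMeasure_one] with y hy
  have h1 : Real.exp (lam * (a - lam⁻¹ * Real.log y - a)) = y⁻¹ := by
    rw [show lam * (a - lam⁻¹ * Real.log y - a) = -Real.log y by field_simp; ring,
      Real.exp_neg, Real.exp_log hy]
  rw [← Complex.exp_add]
  congr 1
  simp only [hh, h1]
  push_cast
  rw [mul_inv]
  ring

/-- The totally asymmetric stable law of index `1`. -/
lemma exists_stable_law :
    ∃ S : ProbabilityMeasure ℝ, ∀ v, charFun (S : Measure ℝ) v = Complex.exp (stableExponent v) := by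
  -- The parameters `0` and `1` are arbitrary: the law of the normalized sum does not depend on
  -- them.
  refine exists_charFun_eq_of_tendsto (μ := fun N => ⟨(Measure.pi fun _ : Fin N =>
    gumbelMeasure 0 1).map (normalizedSum 0 1),
      Measure.isProbabilityMeasure_map (by fun_prop)⟩)
    (continuousAt_stableExponent_zero.cexp) fun v => ?_
  simp only [ProbabilityMeasure.coe_mk, charFun_map_normalizedSum one_pos]
  exact tendsto_exp_mul_invExpCharFun_pow v

/-- The power is the characteristic function of a sum of `k` independent copies of `𝒮`; the shift `k
log k` compensates the lack of strict stability at index `1`. -/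
lemma charFun_map_affine_stable {S : ProbabilityMeasure ℝ}
    (hS : ∀ v, charFun (S : Measure ℝ) v = Complex.exp (stableExponent v)) (k : ℕ) (v : ℝ) :
    charFun ((S : Measure ℝ).map fun y => k * y + k * Real.log k) v
      = Complex.exp (stableExponent v) ^ k := by
  have e : (fun y : ℝ => (k : ℝ) * y + k * Real.log k)
      = (fun y => y + k * Real.log k) ∘ (fun y => (k : ℝ) * y) := rfl
  rw [e, ← Measure.map_map (by fun_prop) (by fun_prop), charFun_map_add_const, charFun_map_mul, hS,
    ← Complex.exp_add, ← Complex.exp_nat_mul]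
  congr 1
  rcases Nat.eq_zero_or_pos k with rfl | hk
  · simp [stableExponent_zero]
  · have hk' : (1 : ℝ) ≤ k := by exact_mod_cast hk
    have := stableExponent_mul hk' v
    push_cast at this
    rw [← this]
    simp
    ring

/-- The analytic half of the delta method. It is used for `h = log (1 + ·)` at scale `m_N` and for
`h = u(x - · / lam)` at scale `log N`; the factor `κ` converts `m_N` into `log N`. -/
lemma tendstoUniformlyOn_mul_slope {h : ℝ → ℝ} {d : ℝ} (hd : HasDerivAt h d 0) {s κ : ℕ → ℝ}
    (hs : Tendsto s atTop atTop) (hκ : Tendsto κ atTop (𝓝 1)) {K : Set ℝ} (hK : IsCompact K) :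
    TendstoUniformlyOn (fun n y => κ n * (s n * (h (y / s n) - h 0))) (fun y => d * y)
      atTop K := by
  obtain ⟨M, hM0, hM⟩ := hK.isBounded.exists_pos_norm_le
  rw [Metric.tendstoUniformlyOn_iff]
  intro ε hε
  have hlit := (hasDerivAt_iff_isLittleO.1 hd).def (c := ε / (4 * M)) (by positivity)
  obtain ⟨δ, hδ, hδ'⟩ := Metric.eventually_nhds_iff.1 hlit
  -- The first bound yields `|κ n| ≤ 2`, so the linearization error `ε / 4` costs at most `ε / 2`;
  -- the second handles `(κ n - 1) d y`, and its `+ 1` covers `d = 0`.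
  have hκ1 := Metric.tendsto_nhds.1 hκ (min 1 (ε / (2 * (|d| * M + 1)))) (by positivity)
  filter_upwards [hs.eventually_gt_atTop 0, hs.eventually_gt_atTop (M / δ), hκ1] with n hn0 hn hκn y hy
  have hyM : |y| ≤ M := hM y hy
  rw [Real.dist_eq, lt_min_iff] at hκn
  have hκ2 : |κ n| ≤ 2 := by
    have := abs_sub_abs_le_abs_sub (κ n) 1
    rw [abs_one] at this
    linarith [hκn.1]
  have hsmall : dist (y / s n) 0 < δ := by
    rw [Real.dist_eq, sub_zero, abs_div, abs_of_pos hn0, div_lt_iff₀ hn0]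
    rw [div_lt_iff₀ hδ] at hn
    linarith
  have hb := hδ' hsmall
  simp only [sub_zero, smul_eq_mul, Real.norm_eq_abs, abs_div, abs_of_pos hn0] at hb
  have e1 : s n * (h (y / s n) - h 0) - d * y = s n * (h (y / s n) - h 0 - y / s n * d) := by
    field_simp
  have hb2 : |s n * (h (y / s n) - h 0) - d * y| ≤ ε / 4 := by
    rw [e1, abs_mul, abs_of_pos hn0]
    calc s n * |h (y / s n) - h 0 - y / s n * d|
        ≤ s n * (ε / (4 * M) * (|y| / s n)) := by gcongr
      _ = ε / (4 * M) * |y| := by field_simp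
      _ ≤ ε / (4 * M) * M := by gcongr
      _ = ε / 4 := by field_simp
  rw [dist_comm, Real.dist_eq]
  have e2 : κ n * (s n * (h (y / s n) - h 0)) - d * y
      = κ n * (s n * (h (y / s n) - h 0) - d * y) + (κ n - 1) * (d * y) := by ring
  have hb3 : |κ n - 1| * |d * y| < ε / 2 := by
    have hdy : |d * y| ≤ |d| * M := by rw [abs_mul]; gcongr
    have hpos : 0 < |d| * M + 1 := by positivity
    have h5 := hκn.2
    rw [lt_div_iff₀ (by positivity)] at h5
    nlinarith [abs_nonneg (κ n - 1), abs_nonneg (d * y)]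
  rw [e2]
  calc _ ≤ |κ n| * |s n * (h (y / s n) - h 0) - d * y| + |κ n - 1| * |d * y| := by
        rw [← abs_mul, ← abs_mul]; exact abs_add_le _ _
    _ < ε := by nlinarith [abs_nonneg (κ n), abs_nonneg (s n * (h (y / s n) - h 0) - d * y)]

lemma tendsto_truncatedMean_atTop : Tendsto truncatedMean atTop atTop := by
  refine tendsto_atTop_mono' atTop ?_ (tendsto_atTop_add_const_right _ (-1) tendsto_log_natCast_atTop)
  filter_upwards [eventually_gt_atTop 0] with N hN
  have := (truncatedMean_bounds hN).1
  linarith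

/-- The sum of the `exp (lam (r_i - a))` is both `exp (lam (Φ(r) - a))` and `N m_N + N V_N`, where
`N m_N = b_N`. -/
lemma log_one_add_normalizedSum_div {a lam : ℝ} (hlam : 0 < lam) {N : ℕ} (hN : 0 < N)
    (hc : 0 < truncatedMean N) (r : Fin N → ℝ) :
    lam * (frontLocation lam r - a) - Real.log (centering N)
      = Real.log (1 + normalizedSum a lam r / truncatedMean N) := by
  have hN' : (0 : ℝ) < N := by exact_mod_cast hN
  have : NeZero N := ⟨hN.ne'⟩
  have hsum : ∑ i, Real.exp (lam * (r i - a)) = Real.exp (lam * (frontLocation lam r - a)) := by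
    have : ∀ i, Real.exp (lam * (r i - a)) = Real.exp (lam * r i) * Real.exp (-(lam * a)) := by
      intro i; rw [← Real.exp_add]; ring_nf
    simp_rw [this]
    rw [← Finset.sum_mul, ← exp_mul_frontLocation hlam, ← Real.exp_add]
    ring_nf
  have e : 1 + normalizedSum a lam r / truncatedMean N
      = Real.exp (lam * (frontLocation lam r - a)) / centering N := by
    rw [normalizedSum, ← Finset.sum_div, Finset.sum_sub_distrib, hsum, centering_eq]
    simp only [Finset.sum_const, Finset.card_univ, Fintype.card_fin, nsmul_eq_mul]
    field_simp
    ring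
  rw [e, Real.log_div (Real.exp_pos _).ne' (by rw [centering_eq]; positivity), Real.log_exp]

variable {Ω : Type*} [MeasurableSpace Ω] {P : Measure Ω} [IsProbabilityMeasure P]

/-- Fluctuations of the front location of `N` i.i.d. Gumbel variables. -/
lemma tendsto_charFun_frontLocation {a lam : ℝ} (hlam : 0 < lam) {r : (N : ℕ) → Ω → Fin N → ℝ}
    (hr : ∀ N, Measurable (r N))
    (hlaw : ∀ N, P.map (r N) = Measure.pi fun _ => gumbelMeasure a lam) (v : ℝ) :
    Tendsto (fun N : ℕ => charFun (P.map fun ω => Real.log N *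
      (lam * (frontLocation lam (r N ω) - a) - Real.log (centering N))) v) atTop
      (𝓝 (Complex.exp (stableExponent v))) := by
  obtain ⟨S, hS⟩ := exists_stable_law
  have hV : TendstoInDistribution (fun N ω => normalizedSum a lam (r N ω)) atTop (fun y => y)
      (fun _ => P) (S : Measure ℝ) := by
    rw [tendstoInDistribution_iff_charFun (fun N => by fun_prop) (by fun_prop)]
    intro v
    rw [Measure.map_id', hS]
    refine (tendsto_exp_mul_invExpCharFun_pow v).congr fun N => ?_
    rw [← charFun_map_normalizedSum (a := a) hlam, ← hlaw, Measure.map_map (by fun_prop) (hr N)]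
    rfl
  have hκ : Tendsto (fun N : ℕ => Real.log N / truncatedMean N) atTop (𝓝 1) := by
    simpa using tendsto_truncatedMean_div_log.inv₀ one_ne_zero
  have hd : HasDerivAt (fun y : ℝ => Real.log (1 + y)) 1 0 := by
    simpa using ((hasDerivAt_id (0 : ℝ)).const_add 1).log (by simp)
  have hD := hV.comp_tendstoUniformlyOn
    (g := fun N y => Real.log N / truncatedMean N * (truncatedMean N *
      (Real.log (1 + y / truncatedMean N) - Real.log (1 + 0)))) (g' := fun y => 1 * y)
    (fun N => by fun_prop) (by fun_prop)
    fun K hK => tendstoUniformlyOn_mul_slope hd tendsto_truncatedMean_atTop hκ hK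
  rw [tendstoInDistribution_iff_charFun hD.forall_aemeasurable hD.aemeasurable_limit] at hD
  simp only [one_mul, Measure.map_id', hS] at hD
  refine (hD v).congr' ?_
  filter_upwards [eventually_gt_atTop 0, tendsto_truncatedMean_atTop.eventually_gt_atTop 0]
    with N hN hc
  congr 2
  ext ω
  rw [log_one_add_normalizedSum_div hlam hN hc]
  simp
  field_simp

end StableLimit

/-! ### Fluctuations of the front and of the profile -/

section Fluctuations

variable {Ω : Type*} {a lam : ℝ} {X₀ : (N : ℕ) → Ω → Fin N → ℝ}
  {ξ : (N : ℕ) → ℕ → Fin N → Fin N → Ω → ℝ}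

lemma frontLocation_randomParticles_succ (hlam : 0 < lam) {N : ℕ} (hN : 0 < N) (t : ℕ) (ω : Ω) :
    frontLocation lam (randomParticles X₀ ξ N (t + 1) ω)
      = frontLocation lam (randomParticles X₀ ξ N t ω)
        + frontLocation lam (recentred lam (X₀ N) (ξ N) t ω) := by
  have : NeZero N := ⟨hN.ne'⟩
  have h := frontLocation_sub hlam (randomParticles X₀ ξ N (t + 1) ω)
    (frontLocation lam (randomParticles X₀ ξ N t ω))
  have e : recentred lam (X₀ N) (ξ N) t ω = fun i => randomParticles X₀ ξ N (t + 1) ω i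
    - frontLocation lam (randomParticles X₀ ξ N t ω) := rfl
  rw [e, h]; ring

lemma frontProfile_randomParticles_succ (N k : ℕ) (x : ℝ) (ω : Ω) :
    frontProfile (randomParticles X₀ ξ N (k + 1) ω)
        (x + frontLocation lam (randomParticles X₀ ξ N k ω))
      = frontProfile (recentred lam (X₀ N) (ξ N) k ω) x :=
  (frontProfile_sub _ _ _).symm

variable [MeasurableSpace Ω] {P : Measure Ω}

lemma measurable_randomParticles (hX₀ : ∀ N, Measurable (X₀ N))
    (hξ_law : ∀ N, ∀ s ≥ 1, ∀ i j, HasGumbelLaw P a lam (ξ N s i j)) (N t : ℕ) :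
    Measurable (randomParticles X₀ ξ N t) :=
  measurable_particles (hX₀ N) (fun s hs i j => (hξ_law N s hs i j).1) t

lemma measurable_recentred (hX₀ : ∀ N, Measurable (X₀ N))
    (hξ_law : ∀ N, ∀ s ≥ 1, ∀ i j, HasGumbelLaw P a lam (ξ N s i j)) (N t : ℕ) :
    Measurable (recentred lam (X₀ N) (ξ N) t) := by
  refine measurable_pi_lambda _ fun i => Measurable.sub ?_ ?_
  · exact (measurable_pi_apply i).comp (measurable_randomParticles hX₀ hξ_law N (t + 1))
  · exact (measurable_frontLocation lam).comp (measurable_randomParticles hX₀ hξ_law N t)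

variable [IsProbabilityMeasure P]

lemma map_randomParticles_recentred (hlam : 0 < lam) (hX₀ : ∀ N, Measurable (X₀ N))
    (hξ_law : ∀ N, ∀ s ≥ 1, ∀ i j, HasGumbelLaw P a lam (ξ N s i j))
    (hξ_indep : ∀ N, iIndepFun
      (fun (p : ℕ × Fin N × Fin N) => ξ N (p.1 + 1) p.2.1 p.2.2) P)
    (hX₀_indep : ∀ N, IndepFun (X₀ N)
      (fun ω (p : ℕ × Fin N × Fin N) => ξ N (p.1 + 1) p.2.1 p.2.2 ω) P) (N t : ℕ) :
    P.map (fun ω => ((X₀ N ω, randomParticles X₀ ξ N t ω), recentred lam (X₀ N) (ξ N) t ω))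
      = (P.map fun ω => (X₀ N ω, randomParticles X₀ ξ N t ω)).prod
        (Measure.pi fun _ => gumbelMeasure a lam) :=
  map_history_recentred hlam (hX₀ N) (hξ_law N) (hξ_indep N) (hX₀_indep N) t

lemma map_recentred (hlam : 0 < lam) (hX₀ : ∀ N, Measurable (X₀ N))
    (hξ_law : ∀ N, ∀ s ≥ 1, ∀ i j, HasGumbelLaw P a lam (ξ N s i j))
    (hξ_indep : ∀ N, iIndepFun
      (fun (p : ℕ × Fin N × Fin N) => ξ N (p.1 + 1) p.2.1 p.2.2) P)
    (hX₀_indep : ∀ N, IndepFun (X₀ N)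
      (fun ω (p : ℕ × Fin N × Fin N) => ξ N (p.1 + 1) p.2.1 p.2.2 ω) P) (N t : ℕ) :
    P.map (recentred lam (X₀ N) (ξ N) t) = Measure.pi fun _ => gumbelMeasure a lam := by
  have hZ : Measurable fun ω => (X₀ N ω, randomParticles X₀ ξ N t ω) :=
    (hX₀ N).prodMk (measurable_randomParticles hX₀ hξ_law N t)
  have hR := measurable_recentred hX₀ hξ_law N t
  have := Measure.isProbabilityMeasure_map (μ := P) hZ.aemeasurable
  have h := congrArg (Measure.map Prod.snd)
    (map_randomParticles_recentred hlam hX₀ hξ_law hξ_indep hX₀_indep N t)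
  rw [Measure.map_map measurable_snd (hZ.prodMk hR), Measure.map_snd_prod, measure_univ,
    one_smul] at h
  exact h

lemma indepFun_randomParticles_recentred (hlam : 0 < lam) (hX₀ : ∀ N, Measurable (X₀ N))
    (hξ_law : ∀ N, ∀ s ≥ 1, ∀ i j, HasGumbelLaw P a lam (ξ N s i j))
    (hξ_indep : ∀ N, iIndepFun
      (fun (p : ℕ × Fin N × Fin N) => ξ N (p.1 + 1) p.2.1 p.2.2) P)
    (hX₀_indep : ∀ N, IndepFun (X₀ N)
      (fun ω (p : ℕ × Fin N × Fin N) => ξ N (p.1 + 1) p.2.1 p.2.2 ω) P) (N t : ℕ) :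
    IndepFun (fun ω => (X₀ N ω, randomParticles X₀ ξ N t ω))
      (recentred lam (X₀ N) (ξ N) t) P := by
  have hZ : Measurable fun ω => (X₀ N ω, randomParticles X₀ ξ N t ω) :=
    (hX₀ N).prodMk (measurable_randomParticles hX₀ hξ_law N t)
  rw [indepFun_iff_map_prod_eq_prod_map_map hZ.aemeasurable
    (measurable_recentred hX₀ hξ_law N t).aemeasurable,
    map_recentred hlam hX₀ hξ_law hξ_indep hX₀_indep]
  exact map_randomParticles_recentred hlam hX₀ hξ_law hξ_indep hX₀_indep N t

/-- The normalized displacement of the front between the times `0` and `k`. -/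
def frontFluctuation (a lam : ℝ) {N : ℕ} (k : ℕ) (p : (Fin N → ℝ) × (Fin N → ℝ)) : ℝ :=
  Real.log N * (lam * (frontLocation lam p.2 - frontLocation lam p.1 - k * a)
    - k * Real.log (centering N))

@[fun_prop]
lemma measurable_frontFluctuation (a lam : ℝ) {N : ℕ} (k : ℕ) :
    Measurable (frontFluctuation a lam k : (Fin N → ℝ) × (Fin N → ℝ) → ℝ) := by
  unfold frontFluctuation; fun_prop

/-- The increment `Φ(X(k+1)) - Φ(X(k))` is `Φ` of the recentred configuration, which is independent
of `(X(0), X(k))`; each time step multiplies the limit by one more factor. -/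
lemma tendsto_charFun_frontFluctuation (hlam : 0 < lam) (hX₀ : ∀ N, Measurable (X₀ N))
    (hξ_law : ∀ N, ∀ s ≥ 1, ∀ i j, HasGumbelLaw P a lam (ξ N s i j))
    (hξ_indep : ∀ N, iIndepFun
      (fun (p : ℕ × Fin N × Fin N) => ξ N (p.1 + 1) p.2.1 p.2.2) P)
    (hX₀_indep : ∀ N, IndepFun (X₀ N)
      (fun ω (p : ℕ × Fin N × Fin N) => ξ N (p.1 + 1) p.2.1 p.2.2 ω) P) (k : ℕ) (v : ℝ) :
    Tendsto (fun N : ℕ => charFun (P.map fun ω =>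
      frontFluctuation a lam k (X₀ N ω, randomParticles X₀ ξ N k ω)) v) atTop
      (𝓝 (Complex.exp (stableExponent v) ^ k)) := by
  induction k with
  | zero =>
    refine tendsto_const_nhds.congr fun N => ?_
    have : (fun ω => frontFluctuation a lam 0 (X₀ N ω, randomParticles X₀ ξ N 0 ω))
        = fun _ => 0 := by
      ext ω; simp [frontFluctuation, randomParticles, particles]
    rw [this, Measure.map_const, measure_univ, one_smul, charFun_dirac]
    simp
  | succ k ih =>
    rw [pow_succ]
    refine (ih.mul (tendsto_charFun_frontLocation hlam
      (measurable_recentred hX₀ hξ_law · k)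
      (map_recentred hlam hX₀ hξ_law hξ_indep hX₀_indep · k) v)).congr' ?_
    filter_upwards [eventually_gt_atTop 0] with N hN
    have hZ : Measurable fun ω => (X₀ N ω, randomParticles X₀ ξ N k ω) :=
      (hX₀ N).prodMk (measurable_randomParticles hX₀ hξ_law N k)
    have hR := measurable_recentred hX₀ hξ_law N k
    have hind := (indepFun_randomParticles_recentred hlam hX₀ hξ_law hξ_indep hX₀_indep N k).comp
      (φ := frontFluctuation a lam k)
      (ψ := fun r => Real.log N * (lam * (frontLocation lam r - a) - Real.log (centering N)))
      (by fun_prop) (by fun_prop)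
    have h := hind.charFun_map_add_eq_mul
      ((measurable_frontFluctuation a lam k).comp hZ).aemeasurable
      (Measurable.comp (by fun_prop) hR).aemeasurable
    have h' := congrFun h v
    rw [Pi.mul_apply] at h'
    refine h'.symm.trans ?_
    congr 2
    ext ω
    simp only [Pi.add_apply, Function.comp, frontFluctuation,
      frontLocation_randomParticles_succ hlam hN]
    push_cast
    ring

lemma tendstoInDistribution_frontFluctuation (hlam : 0 < lam) (hX₀ : ∀ N, Measurable (X₀ N))
    (hξ_law : ∀ N, ∀ s ≥ 1, ∀ i j, HasGumbelLaw P a lam (ξ N s i j))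
    (hξ_indep : ∀ N, iIndepFun
      (fun (p : ℕ × Fin N × Fin N) => ξ N (p.1 + 1) p.2.1 p.2.2) P)
    (hX₀_indep : ∀ N, IndepFun (X₀ N)
      (fun ω (p : ℕ × Fin N × Fin N) => ξ N (p.1 + 1) p.2.1 p.2.2 ω) P)
    {S : ProbabilityMeasure ℝ}
    (hS : ∀ v, charFun (S : Measure ℝ) v = Complex.exp (stableExponent v)) (k : ℕ) :
    TendstoInDistribution (fun N ω =>
      frontFluctuation a lam k (X₀ N ω, randomParticles X₀ ξ N k ω)) atTop
      (fun y => k * y + k * Real.log k) (fun _ => P) (S : Measure ℝ) := by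
  refine (tendstoInDistribution_iff_charFun (fun N =>
    ((measurable_frontFluctuation a lam k).comp
      ((hX₀ N).prodMk (measurable_randomParticles hX₀ hξ_law N k))).aemeasurable)
    (by fun_prop)).2 fun v => ?_
  rw [charFun_map_affine_stable hS]
  exact tendsto_charFun_frontFluctuation hlam hX₀ hξ_law hξ_indep hX₀_indep k v

/-- Hoeffding's inequality for the recentred profile, at a level that depends on the past. -/
lemma measureReal_recentred_ge_le (hlam : 0 < lam) (hX₀ : ∀ N, Measurable (X₀ N))
    (hξ_law : ∀ N, ∀ s ≥ 1, ∀ i j, HasGumbelLaw P a lam (ξ N s i j))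
    (hξ_indep : ∀ N, iIndepFun
      (fun (p : ℕ × Fin N × Fin N) => ξ N (p.1 + 1) p.2.1 p.2.2) P)
    (hX₀_indep : ∀ N, IndepFun (X₀ N)
      (fun ω (p : ℕ × Fin N × Fin N) => ξ N (p.1 + 1) p.2.1 p.2.2 ω) P) {N : ℕ} (hN : 0 < N)
    (k : ℕ) {f : (Fin N → ℝ) × (Fin N → ℝ) → ℝ} (hf : Measurable f) {ε : ℝ} (hε : 0 ≤ ε) :
    P.real {ω | ε ≤ |frontProfile (recentred lam (X₀ N) (ξ N) k ω)
        (f (X₀ N ω, randomParticles X₀ ξ N k ω))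
      - limitProfile a lam (f (X₀ N ω, randomParticles X₀ ξ N k ω))|}
      ≤ 2 * Real.exp (-(2 * N * ε ^ 2)) := by
  have hZ : Measurable fun ω => (X₀ N ω, randomParticles X₀ ξ N k ω) :=
    (hX₀ N).prodMk (measurable_randomParticles hX₀ hξ_law N k)
  have hR := measurable_recentred hX₀ hξ_law N k
  have := Measure.isProbabilityMeasure_map (μ := P) hZ.aemeasurable
  have hA : MeasurableSet {q : ((Fin N → ℝ) × (Fin N → ℝ)) × (Fin N → ℝ) |
      ε ≤ |frontProfile q.2 (f q.1) - limitProfile a lam (f q.1)|} := by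
    refine measurableSet_le measurable_const (Measurable.abs (Measurable.sub ?_ ?_))
    · exact measurable_frontProfile.comp (measurable_snd.prodMk (hf.comp measurable_fst))
    · exact (continuous_limitProfile a lam).measurable.comp (hf.comp measurable_fst)
  have hpre : {ω | ε ≤ |frontProfile (recentred lam (X₀ N) (ξ N) k ω)
        (f (X₀ N ω, randomParticles X₀ ξ N k ω))
      - limitProfile a lam (f (X₀ N ω, randomParticles X₀ ξ N k ω))|}
      = (fun ω => ((X₀ N ω, randomParticles X₀ ξ N k ω), recentred lam (X₀ N) (ξ N) k ω)) ⁻¹'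
        {q | ε ≤ |frontProfile q.2 (f q.1) - limitProfile a lam (f q.1)|} := rfl
  rw [hpre, ← map_measureReal_apply (hZ.prodMk hR) hA,
    map_randomParticles_recentred hlam hX₀ hξ_law hξ_indep hX₀_indep, measureReal_def,
    Measure.prod_apply hA]
  refine ENNReal.toReal_le_of_le_ofReal (by positivity) ?_
  -- Once the past is frozen by Fubini the level is deterministic, and Hoeffding's bound does not
  -- depend on it.
  calc _ ≤ ∫⁻ _, ENNReal.ofReal (2 * Real.exp (-(2 * N * ε ^ 2)))
        ∂(P.map fun ω => (X₀ N ω, randomParticles X₀ ξ N k ω)) := by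
        refine lintegral_mono fun p => ?_
        have h := measureReal_abs_frontProfile_sub_ge_le (a := a) hlam hN (f p) hε
        rw [measureReal_def] at h
        exact (ENNReal.le_ofReal_iff_toReal_le (measure_ne_top _ _) (by positivity)).2 h
    _ = _ := by simp

lemma differentiable_limitProfile (a lam : ℝ) : Differentiable ℝ (limitProfile a lam) := by
  unfold limitProfile; fun_prop

/-- Since `N / (log N)² → ∞`, the sampling error of the profile is negligible at the scale `1 / log
N`. -/
lemma tendsto_exp_neg_mul_div_log_sq {c : ℝ} (hc : 0 < c) :
    Tendsto (fun N : ℕ => 2 * Real.exp (-(2 * N * (c / Real.log N) ^ 2))) atTop (𝓝 0) := by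
  have h1 : Tendsto (fun N : ℕ => Real.log N ^ 2 / N) atTop (𝓝 0) :=
    ((Real.isLittleO_pow_log_id_atTop (n := 2)).tendsto_div_nhds_zero).comp
      tendsto_natCast_atTop_atTop
  have h2 : Tendsto (fun N : ℕ => (Real.log N ^ 2 / N)⁻¹) atTop atTop := by
    refine Tendsto.inv_tendsto_nhdsGT_zero (tendsto_nhdsWithin_iff.2 ⟨h1, ?_⟩)
    filter_upwards [tendsto_log_natCast_atTop.eventually_gt_atTop 0, eventually_gt_atTop 0]
      with N hlog hN
    have : (0 : ℝ) < N := by exact_mod_cast hN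
    exact div_pos (by positivity) this
  have h3 := (Real.tendsto_exp_atBot.comp (tendsto_neg_atTop_atBot.comp
    (h2.const_mul_atTop (by positivity : 0 < 2 * c ^ 2)))).const_mul 2
  rw [mul_zero] at h3
  refine h3.congr fun N => ?_
  simp only [Function.comp, inv_div, div_pow]
  rw [mul_div_assoc']
  congr 3
  ring

/-- Relative to `Φ(X(k))`, the profile is evaluated at `x - F / (lam log N)`, with `F` the front
fluctuation. Replacing the profile by `u` costs `o(1 / log N)` in probability, and expanding `u` at
`x` gives the limit. -/
lemma tendstoInDistribution_frontProfile (hlam : 0 < lam) (hX₀ : ∀ N, Measurable (X₀ N))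
    (hξ_law : ∀ N, ∀ s ≥ 1, ∀ i j, HasGumbelLaw P a lam (ξ N s i j))
    (hξ_indep : ∀ N, iIndepFun
      (fun (p : ℕ × Fin N × Fin N) => ξ N (p.1 + 1) p.2.1 p.2.2) P)
    (hX₀_indep : ∀ N, IndepFun (X₀ N)
      (fun ω (p : ℕ × Fin N × Fin N) => ξ N (p.1 + 1) p.2.1 p.2.2 ω) P)
    {S : ProbabilityMeasure ℝ}
    (hS : ∀ v, charFun (S : Measure ℝ) v = Complex.exp (stableExponent v)) (k : ℕ) (x : ℝ) :
    TendstoInDistribution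
      (fun (N : ℕ) (ω : Ω) => Real.log N *
        (frontProfile (randomParticles X₀ ξ N (k + 1) ω)
          (x + k * (lam⁻¹ * Real.log (centering N) + a) + frontLocation lam (X₀ N ω))
          - limitProfile a lam x)) atTop
      (fun y : ℝ => -(deriv (limitProfile a lam) x / lam) * (k * y + k * Real.log k))
      (fun _ => P) (S : Measure ℝ) := by
  have hd : HasDerivAt (fun y => limitProfile a lam (x - y / lam))
      (-(deriv (limitProfile a lam) x / lam)) 0 := by
    have h1 : HasDerivAt (fun y => x - y / lam) (-(1 / lam)) 0 :=
      ((hasDerivAt_id (0 : ℝ)).div_const lam).const_sub x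
    have h2 : HasDerivAt (limitProfile a lam) (deriv (limitProfile a lam) x) (x - 0 / lam) := by
      rw [zero_div, sub_zero]
      exact (differentiable_limitProfile a lam x).hasDerivAt
    have h3 : HasDerivAt (fun y => limitProfile a lam (x - y / lam))
        (deriv (limitProfile a lam) x * -(1 / lam)) 0 :=
      HasDerivAt.comp (h₂ := limitProfile a lam) (h := fun y => x - y / lam) 0 h2 h1
    exact h3.congr_deriv (by ring)
  have hmain := (tendstoInDistribution_frontFluctuation hlam hX₀ hξ_law hξ_indep hX₀_indep hS
    k).comp_tendstoUniformlyOn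
    (g := fun N y => 1 * (Real.log N * (limitProfile a lam (x - y / Real.log N / lam)
      - limitProfile a lam (x - 0 / lam))))
    (g' := fun y => -(deriv (limitProfile a lam) x / lam) * y)
    (fun N => by
      have := (continuous_limitProfile a lam).measurable
      fun_prop) (by fun_prop)
    fun K hK => tendstoUniformlyOn_mul_slope hd tendsto_log_natCast_atTop tendsto_const_nhds hK
  refine tendstoInDistribution_of_tendstoInMeasure_sub _ _ hmain ?_ fun N => ?_
  · rw [tendstoInMeasure_iff_measureReal_norm]
    intro ε hε
    refine squeeze_zero' (Eventually.of_forall fun N => measureReal_nonneg) ?_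
      (tendsto_exp_neg_mul_div_log_sq hε)
    filter_upwards [tendsto_log_natCast_atTop.eventually_gt_atTop 0, eventually_gt_atTop 0]
      with N hlog hN
    have hf : Measurable (fun p : (Fin N → ℝ) × (Fin N → ℝ) =>
      x + k * (lam⁻¹ * Real.log (centering N) + a) + frontLocation lam p.1
        - frontLocation lam p.2) := by fun_prop
    refine le_trans (measureReal_mono fun ω hω => ?_)
      (measureReal_recentred_ge_le hlam hX₀ hξ_law hξ_indep hX₀_indep hN k hf
        (div_nonneg hε.le hlog.le))
    have e1 := frontProfile_randomParticles_succ (X₀ := X₀) (ξ := ξ) (lam := lam) N k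
      (x + k * (lam⁻¹ * Real.log (centering N) + a) + frontLocation lam (X₀ N ω)
        - frontLocation lam (randomParticles X₀ ξ N k ω)) ω
    rw [sub_add_cancel] at e1
    have e2 : x - frontFluctuation a lam k (X₀ N ω, randomParticles X₀ ξ N k ω) / Real.log N / lam
        = x + k * (lam⁻¹ * Real.log (centering N) + a) + frontLocation lam (X₀ N ω)
        - frontLocation lam (randomParticles X₀ ξ N k ω) := by
      rw [frontFluctuation]
      field_simp
      ring
    simp only [Set.mem_ofPred_eq, Pi.sub_apply, Pi.zero_apply, sub_zero, Real.norm_eq_abs, e1, e2,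
      zero_div, one_mul, ← mul_sub, sub_sub_sub_cancel_right] at hω ⊢
    rw [abs_mul, abs_of_pos hlog] at hω
    rwa [div_le_iff₀' hlog]
  · refine (Measurable.const_mul (Measurable.sub_const (measurable_frontProfile.comp
      ((measurable_randomParticles hX₀ hξ_law N (k + 1)).prodMk ?_)) _) _).aemeasurable
    have := hX₀ N
    fun_prop

end Fluctuations

/-! ### Conclusion -/

lemma pastSigmaAlgebra_le {Ω : Type*} [m : MeasurableSpace Ω] {X₀ : (N : ℕ) → Ω → Fin N → ℝ}
    {ξ : (N : ℕ) → ℕ → Fin N → Fin N → Ω → ℝ} (hX₀ : ∀ N, Measurable (X₀ N))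
    (hξ : ∀ N, ∀ s ≥ 1, ∀ i j, Measurable (ξ N s i j)) (t : ℕ) :
    pastSigmaAlgebra X₀ ξ t ≤ m :=
  sup_le (iSup_le fun N => (hX₀ N).comap_le) (iSup_le fun N => iSup_le fun s => iSup_le fun hs =>
    iSup_le fun i => iSup_le fun j => (hξ N s hs.1 i j).comap_le)

end

theorem proposition4p3 {Ω : Type*} [MeasurableSpace Ω] (P : Measure Ω) [IsProbabilityMeasure P]
    (a lam : ℝ) (hlam : 0 < lam)
    (X₀ : (N : ℕ) → Ω → Fin N → ℝ) (ξ : (N : ℕ) → ℕ → Fin N → Fin N → Ω → ℝ)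
    (hX₀ : ∀ N, Measurable (X₀ N))
    (hξ_law : ∀ N, ∀ s ≥ 1, ∀ i j, HasGumbelLaw P a lam (ξ N s i j))
    (hξ_indep : ∀ N, iIndepFun
      (fun (p : ℕ × Fin N × Fin N) => ξ N (p.1 + 1) p.2.1 p.2.2) P)
    (hX₀_indep : ∀ N, IndepFun (X₀ N)
      (fun ω (p : ℕ × Fin N × Fin N) => ξ N (p.1 + 1) p.2.1 p.2.2 ω) P) :
    (∀ t : ℕ, 1 ≤ t →
      (∀ᵐ ω ∂P, ω ∈ profileConvergence a lam X₀ ξ t) ∧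
      P[(profileConvergence a lam X₀ ξ t).indicator (fun _ => (1 : ℝ)) |
        pastSigmaAlgebra X₀ ξ (t - 1)] =ᵐ[P] fun _ => 1) ∧
    ∃ 𝒮 : ProbabilityMeasure ℝ,
      (∀ v : ℝ, charFun (𝒮 : Measure ℝ) v = Complex.exp (stableExponent v)) ∧
      ∀ t : ℕ, 1 ≤ t → ∀ x : ℝ,
        TendstoInDistribution
          (fun (N : ℕ) (ω : Ω) => Real.log N *
            (frontProfile (randomParticles X₀ ξ N t ω)
              (x + ((t : ℝ) - 1) * (lam⁻¹ * Real.log (centering N) + a)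
                + frontLocation lam (X₀ N ω))
              - limitProfile a lam x))
          atTop
          (fun S : ℝ => -(deriv (limitProfile a lam) x / lam) *
            (((t : ℝ) - 1) * S + ((t : ℝ) - 1) * Real.log ((t : ℝ) - 1)))
          (fun _ => P) (𝒮 : Measure ℝ) := by
  refine ⟨fun t ht => ?_, ?_⟩
  · obtain ⟨k, rfl⟩ := Nat.exists_eq_add_of_le' ht
    have hae : ∀ᵐ ω ∂P, ω ∈ profileConvergence a lam X₀ ξ (k + 1) := by
      filter_upwards [ae_tendstoUniformly_frontProfile hlam
        (measurable_recentred hX₀ hξ_law · k)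
        (map_recentred hlam hX₀ hξ_law hξ_indep hX₀_indep · k)] with ω hω
      simpa only [profileConvergence, Set.mem_ofPred_eq, Nat.add_sub_cancel,
        frontProfile_randomParticles_succ] using hω
    refine ⟨hae, ?_⟩
    -- The indicator is almost surely the constant `1`, so the conditional statement follows from
    -- the unconditional one, without proving the event measurable.
    have hone : (profileConvergence a lam X₀ ξ (k + 1)).indicator (fun _ => (1 : ℝ))
        =ᵐ[P] fun _ => 1 := by
      filter_upwards [hae] with ω hω
      rw [Set.indicator_of_mem hω]
    refine (condExp_congr_ae hone).trans ?_
    rw [condExp_const (pastSigmaAlgebra_le hX₀ (fun N s hs i j => (hξ_law N s hs i j).1) _)]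
  · obtain ⟨S, hS⟩ := exists_stable_law
    refine ⟨S, hS, fun t ht x => ?_⟩
    obtain ⟨k, rfl⟩ := Nat.exists_eq_add_of_le' ht
    have := tendstoInDistribution_frontProfile hlam hX₀ hξ_law hξ_indep hX₀_indep hS k x
    simpa only [Nat.cast_add, Nat.cast_one, add_sub_cancel_right] using this
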